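/- Let $d\ge 2$. For finite sets $F_1,\dots,F_k\subset\mathbb{Z}^d$, a joint co-tile is a set $A\subseteq\mathbb{Z}^d$ such that, for every $1\le i\le k$, each $x\in\mathbb{Z}^d$ has a unique representation $x=f+a$ with $f\in F_i$ and $a\in A$. A set $A\subseteq\mathbb{Z}^d$ is $d$-periodic if there is a subgroup $L\le\mathbb{Z}^d$ of rank $d$ such that $A+L=A$. Write $F^*=F\setminus\{0\}$. A tuple $(F_1,\dots,F_{d-1})$ of finite subsets of $\mathbb{Z}^d$ has property $(\star)$ if (i) $0\in F_i$ for every $1\le i\le d-1$, and for every $(v_1,\dots,v_{d-1})\in F_1^*\times\cdots\times F_{d-1}^*$ the vectors $v_1,\dots,v_{d-1}$ are linearly independent; and (ii) for all $(v_1,\dots,v_{d-1}),(w_1,\dots,w_{d-1})\in F_1^*\times\cdots\times F_{d-1}^*$ with $\operatorname{span}_{\mathbb{R}}(v_1,\dots,v_{d-1})=\operatorname{span}_{\mathbb{R}}(w_1,\dots,w_{d-1})$ we have $v_i=w_i$ for all $1\le i\le d-2$. If a tuple $(F_1,\dots,F_{d-1})$ of finite subsets of $\mathbb{Z}^d$ has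 property $(\star)$ and admits a joint co-tile, then it admits a $d$-periodic joint co-tile. -/

import Mathlib

open scoped Pointwise

namespace JointTiling

/-- `A` is a co-tile for the finite set `F` in the abelian group `Γ`, that is `F ⊕ A = Γ`:
every element of `Γ` has a unique representation `f + a` with `f ∈ F` and `a ∈ A`. -/
def IsCoTile {Γ : Type*} [AddCommGroup Γ] (F : Finset Γ) (A : Set Γ) : Prop :=
  ∀ x : Γ, ∃! p : Γ × Γ, p.1 ∈ F ∧ p.2 ∈ A ∧ p.1 + p.2 = x

/-- `A` is a joint co-tile for the tuple `F` of finite sets. -/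
def IsJointCoTile {Γ : Type*} [AddCommGroup Γ] {k : ℕ} (F : Fin k → Finset Γ)
    (A : Set Γ) : Prop :=
  ∀ i, IsCoTile (F i) A

/-- `C` is `k`-periodic: `C + L = C` for some subgroup `L` of rank at least `k`. The rank of an
abelian group is its rank as a `ℤ`-module (the maximal size of a `ℤ`-independent set). -/
def IsPeriodicOfRank {Γ : Type*} [AddCommGroup Γ] (k : ℕ) (C : Set Γ) : Prop :=
  ∃ L : AddSubgroup Γ, (k : Cardinal) ≤ Module.rank ℤ L ∧ C + (L : Set Γ) = C

/-- `v` is an element of `F₁* × ⋯ × Fₖ*`, where `F* = F \ {0}`. -/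
def IsNonzeroChoice {Γ : Type*} [AddCommGroup Γ] {k : ℕ} (F : Fin k → Finset Γ)
    (v : Fin k → Γ) : Prop :=
  ∀ i, v i ∈ F i ∧ v i ≠ 0

/-- `F` is an independent tuple of tiles: `0` belongs to every tile and every tuple in
`F₁* × ⋯ × Fₖ*` is independent over `ℤ`. -/
def IsIndependentTuple {Γ : Type*} [AddCommGroup Γ] {k : ℕ} (F : Fin k → Finset Γ) : Prop :=
  (∀ i, 0 ∈ F i) ∧ ∀ v : Fin k → Γ, IsNonzeroChoice F v → LinearIndependent ℤ v

/-- The real linear subspace of `ℝ^d` spanned by a tuple of vectors of `ℤ^d`. -/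
def realSpan {d k : ℕ} (v : Fin k → Fin d → ℤ) : Submodule ℝ (Fin d → ℝ) :=
  Submodule.span ℝ (Set.range fun i : Fin k => fun j : Fin d => (v i j : ℝ))

/-- Property `(⋆)` of a tuple of `d - 1` tiles in `ℤ^d` (for `d ≥ 2`): the tuple is independent,
and if two tuples in `F₁* × ⋯ × F_{d-1}*` span the same subspace, then they agree in each of the
first `d - 2` entries, i.e. in all entries except possibly the last one. -/
def PropertyStar {d : ℕ} (F : Fin (d - 1) → Finset (Fin d → ℤ)) : Prop :=
  IsIndependentTuple F ∧
    ∀ v w : Fin (d - 1) → Fin d → ℤ, IsNonzeroChoice F v → IsNonzeroChoice F w →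
      realSpan v = realSpan w → ∀ i : Fin (d - 1), (i : ℕ) < d - 2 → v i = w i

end JointTiling

/-! Let `φ` be the indicator of the co-tile `A`. Tiling by `F i` forces tiling by every dilate `(1 +
Q n) F i` when `Q` is divisible by `(F i).card!` (`sum_translate_one_add_mul_smul`, via Frobenius
modulo primes). The element `0` does not move under dilation, so averaging over `n` writes `φ` as
`1` minus a sum of averages, one for each nonzero `g` in the tile, invariant under `Q g`. These
averages satisfy the same tiling equations, so the expansion continues with the next tile. After `d
- 1` tiles every term is invariant under multiples of `d - 1` independent vectors, hence along a
hyperplane.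

Group the final terms by hyperplane. Their total is an integer (`exists_int_sum_iterAvg`), and
differencing along vectors that split between two hyperplanes shows that each group is polynomial
modulo one. Part (ii) of the star property makes a group a block of a single expansion, so its
values lie in `[0, 1]`. By Weyl, on each coset of a suitable `n G` a group is constant or comes
arbitrarily close to both `0` and `1` (`exists_modulus_constOrSpread`). Two summands spread along
different hyperplanes would both be near `1` at a common point, contradicting a sum at most `1`.
Climbing back up the expansion (`Good.one_sub_sum`, `exists_good`), `φ` is on each coset constant or
invariant along one hyperplane.

Finally cut `A` into pieces, one per hyperplane. The representation counts of the pieces are bounded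
and polynomial, hence periodic, and a pigeonhole transverse to the hyperplane replaces each piece by
a fully periodic one with equal counts (`exists_periodic_of_reprCount_periodic`). The new pieces
together form the periodic co-tile (`exists_periodic_of_good`). -/

namespace JointTiling

open Filter Topology

/-! ### Shift-invariant means of bounded sequences -/

section Mean

variable {E : Type*} [NormedAddCommGroup E] [NormedSpace ℝ E]

/-- The Cesàro averages of a sequence. -/
noncomputable def cesaro (u : ℕ → E) (N : ℕ) : E := (N : ℝ)⁻¹ • ∑ n ∈ Finset.range N, u n

/-- A shift-invariant mean: the limit of the Cesàro averages along a nonprincipal ultrafilter. -/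
noncomputable def mean (u : ℕ → E) : E := limUnder (hyperfilter ℕ : Filter ℕ) (cesaro u)

lemma norm_cesaro_le {u : ℕ → E} {C : ℝ} (hC : ∀ n, ‖u n‖ ≤ C) (N : ℕ) : ‖cesaro u N‖ ≤ C := by
  have hC0 : 0 ≤ C := (norm_nonneg _).trans (hC 0)
  rcases Nat.eq_zero_or_pos N with rfl | hN
  · simpa [cesaro] using hC0
  have hN' : (0 : ℝ) < N := by exact_mod_cast hN
  calc ‖cesaro u N‖ = (N : ℝ)⁻¹ * ‖∑ n ∈ Finset.range N, u n‖ := by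
        rw [cesaro, norm_smul, Real.norm_of_nonneg (by positivity)]
    _ ≤ (N : ℝ)⁻¹ * ∑ n ∈ Finset.range N, C := by
        gcongr
        exact norm_sum_le_of_le _ fun n _ => hC n
    _ = C := by
        rw [Finset.sum_const, Finset.card_range, nsmul_eq_mul]
        field_simp

lemma mean_eq_of_tendsto {u : ℕ → E} {z : E}
    (h : Tendsto (cesaro u) (hyperfilter ℕ : Filter ℕ) (𝓝 z)) : mean u = z :=
  h.limUnder_eq

lemma mean_const (z : E) : mean (fun _ => z) = z := by
  apply mean_eq_of_tendsto
  have h : ∀ᶠ N : ℕ in atTop, cesaro (fun _ => z) N = z := by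
    filter_upwards [eventually_gt_atTop 0] with N hN
    have hN' : (N : ℝ) ≠ 0 := by positivity
    rw [cesaro, Finset.sum_const, Finset.card_range, ← Nat.cast_smul_eq_nsmul ℝ, smul_smul,
      inv_mul_cancel₀ hN', one_smul]
  exact (tendsto_const_nhds.congr' (h.mono fun _ h => h.symm)).mono_left
    Nat.hyperfilter_le_atTop

variable [ProperSpace E]

lemma tendsto_cesaro {u : ℕ → E} {C : ℝ} (hC : ∀ n, ‖u n‖ ≤ C) :
    Tendsto (cesaro u) (hyperfilter ℕ : Filter ℕ) (𝓝 (mean u)) := by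
  have hle : ((hyperfilter ℕ).map (cesaro u) : Filter E) ≤ 𝓟 (Metric.closedBall 0 C) := by
    rw [le_principal_iff, Ultrafilter.mem_coe, Ultrafilter.mem_map]
    exact Filter.univ_mem' fun N => by simpa using norm_cesaro_le hC N
  obtain ⟨z, -, hz⟩ := (isCompact_closedBall (0 : E) C).ultrafilter_le_nhds _ hle
  exact tendsto_nhds_limUnder ⟨z, hz⟩

lemma norm_mean_le {u : ℕ → E} {C : ℝ} (hC : ∀ n, ‖u n‖ ≤ C) : ‖mean u‖ ≤ C :=
  le_of_tendsto (tendsto_cesaro hC).norm (Eventually.of_forall fun N => norm_cesaro_le hC N)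

lemma mean_add {u v : ℕ → E} {C D : ℝ} (hu : ∀ n, ‖u n‖ ≤ C) (hv : ∀ n, ‖v n‖ ≤ D) :
    mean (fun n => u n + v n) = mean u + mean v := by
  apply mean_eq_of_tendsto
  refine ((tendsto_cesaro hu).add (tendsto_cesaro hv)).congr fun N => ?_
  simp [cesaro, Finset.sum_add_distrib]

lemma mean_map {E' : Type*} [NormedAddCommGroup E'] [NormedSpace ℝ E'] [ProperSpace E']
    (L : E →L[ℝ] E') {u : ℕ → E} {C : ℝ} (hu : ∀ n, ‖u n‖ ≤ C) :
    mean (fun n => L (u n)) = L (mean u) := by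
  apply mean_eq_of_tendsto
  refine ((L.continuous.tendsto _).comp (tendsto_cesaro hu)).congr fun N => ?_
  simp [cesaro]

lemma mean_sum {κ : Type*} (s : Finset κ) {u : κ → ℕ → E} {C : ℝ}
    (hu : ∀ i ∈ s, ∀ n, ‖u i n‖ ≤ C) :
    mean (fun n => ∑ i ∈ s, u i n) = ∑ i ∈ s, mean (u i) := by
  classical
  induction s using Finset.induction_on with
  | empty => simpa using mean_const (0 : E)
  | insert a s ha ih =>
    simp only [Finset.sum_insert ha]
    rw [mean_add (hu a (Finset.mem_insert_self _ _))
      (D := ∑ _i ∈ s, C) fun n => norm_sum_le_of_le _ fun i hi =>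
        hu i (Finset.mem_insert_of_mem hi) n, ih fun i hi => hu i (Finset.mem_insert_of_mem hi)]

lemma mean_shift {u : ℕ → E} {C : ℝ} (hu : ∀ n, ‖u n‖ ≤ C) :
    mean (fun n => u (n + 1)) = mean u := by
  apply mean_eq_of_tendsto
  have h0 : Tendsto (fun N : ℕ => (N : ℝ)⁻¹ • (u N - u 0)) (hyperfilter ℕ : Filter ℕ) (𝓝 0) := by
    refine Tendsto.mono_left ?_ Nat.hyperfilter_le_atTop
    refine squeeze_zero_norm (a := fun N : ℕ => (N : ℝ)⁻¹ * (C + C)) (fun N => ?_) ?_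
    · rw [norm_smul, Real.norm_of_nonneg (by positivity)]
      gcongr
      exact (norm_sub_le _ _).trans (add_le_add (hu _) (hu _))
    · simpa using tendsto_inv_atTop_nhds_zero_nat.mul_const (C + C)
  refine (add_zero (mean u) ▸ (tendsto_cesaro hu).add h0).congr fun N => ?_
  rw [cesaro, cesaro, ← smul_add]
  congr 1
  have h1 := Finset.sum_range_succ u N
  have h2 := Finset.sum_range_succ' u N
  rw [h1] at h2
  rw [add_sub, h2, add_sub_cancel_right]

lemma mean_shift_nat {u : ℕ → E} {C : ℝ} (hu : ∀ n, ‖u n‖ ≤ C) (h : ℕ) :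
    mean (fun n => u (n + h)) = mean u := by
  induction h with
  | zero => rfl
  | succ h ih =>
    rw [← ih, ← mean_shift (u := fun n => u (n + h)) fun n => hu _]
    congr 1; ext n; congr 1; ring

lemma mean_nonneg {u : ℕ → ℝ} {C : ℝ} (hC : ∀ n, ‖u n‖ ≤ C) (h : ∀ n, 0 ≤ u n) : 0 ≤ mean u :=
  ge_of_tendsto (tendsto_cesaro hC) (Eventually.of_forall fun N => by
    unfold cesaro
    exact smul_nonneg (by positivity) (Finset.sum_nonneg fun n _ => h n))

end Mean

/-! ### Van der Corput's inequality -/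

section Weyl

open Complex ComplexConjugate

/-- **Van der Corput's lemma** for shift-invariant means. -/
lemma mean_eq_zero_of_correlations {u : ℕ → ℂ} (hu : ∀ n, ‖u n‖ ≤ 1)
    (h0 : ∀ h : ℕ, 0 < h → mean (fun n => u (n + h) * conj (u n)) = 0) : mean u = 0 := by
  set z := mean u with hz
  have hcorr : ∀ a b n, ‖u (n + a) * conj (u (n + b))‖ ≤ 1 := fun a b n => by
    rw [norm_mul, RCLike.norm_conj]
    exact mul_le_one₀ (hu _) (norm_nonneg _) (hu _)
  have hoff : ∀ a b : ℕ, a ≠ b → mean (fun n => u (n + a) * conj (u (n + b))) = 0 := by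
    intro a b hab
    rcases lt_or_gt_of_ne hab with h | h
    · have h1 := mean_shift_nat (u := fun n => u (n + (b - a)) * conj (u n))
        (fun n => hcorr (b - a) 0 n) a
      rw [h0 (b - a) (by omega)] at h1
      have h2 := mean_map (Complex.conjCLE : ℂ →L[ℝ] ℂ) (fun n => hcorr b a n)
      have h3 : (fun n => u (n + b) * conj (u (n + a))) =
          fun n => u (n + a + (b - a)) * conj (u (n + a)) := by
        ext n; congr 2; omega
      rw [h3] at h2
      rw [h1] at h2
      rw [map_zero] at h2
      rw [← h2]
      congr 1; ext n
      simp [mul_comm]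
    · have h1 := mean_shift_nat (u := fun n => u (n + (a - b)) * conj (u n))
        (fun n => hcorr (a - b) 0 n) b
      rw [h0 (a - b) (by omega)] at h1
      rw [← h1]
      congr 1; ext n; congr 2; omega
  -- Expand the nonnegative mean of `‖∑ u (n + a) - H z‖ ^ 2`, with `a < H`. Only diagonal
  -- correlations survive, contributing at most `H`, and the remaining terms give `-H ^ 2 ‖z‖ ^ 2`.
  have key : ∀ H : ℕ, 0 < H → (H : ℝ) * ‖z‖ ^ 2 ≤ 1 := by
    intro H hH
    set s : ℂ := H * z with hs
    have hub : ∀ a n, ‖u (n + a)‖ ≤ 1 := fun a n => hu _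
    have hb1 : ∀ p ∈ Finset.range H ×ˢ Finset.range H, ∀ n,
        ‖u (n + p.1) * conj (u (n + p.2))‖ ≤ 1 := fun p _ n => hcorr _ _ n
    have e1 : mean (fun n => ∑ p ∈ Finset.range H ×ˢ Finset.range H,
        u (n + p.1) * conj (u (n + p.2))) =
        ∑ a ∈ Finset.range H, mean (fun n => u (n + a) * conj (u (n + a))) := by
      rw [mean_sum _ hb1, Finset.sum_product]
      refine Finset.sum_congr rfl fun a ha => ?_
      rw [Finset.sum_eq_single a (fun b _ hb => hoff a b hb.symm) (fun h => absurd ha h)]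
    have e2 : mean (fun n => ∑ a ∈ Finset.range H, u (n + a)) = H * z := by
      rw [mean_sum _ fun a _ => hub a]
      simp [mean_shift_nat hu, hz]
    set R : ℂ →L[ℝ] ℝ := Complex.reCLM with hR
    have hbS : ∀ n, ‖∑ a ∈ Finset.range H, u (n + a)‖ ≤ H := fun n => by
      refine (norm_sum_le_of_le _ fun a _ => hub a n).trans ?_
      simp
    have hbP : ∀ n, ‖∑ p ∈ Finset.range H ×ˢ Finset.range H,
        u (n + p.1) * conj (u (n + p.2))‖ ≤ H * H := fun n => by
      refine (norm_sum_le_of_le _ fun p hp => hb1 p hp n).trans ?_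
      simp
    let L : ℂ →L[ℝ] ℝ := R.comp ((ContinuousLinearMap.mul ℝ ℂ) (conj s))
    have hL : ∀ w, L w = (conj s * w).re := fun w => rfl
    have hid : ∀ n, ‖(∑ a ∈ Finset.range H, u (n + a)) - s‖ ^ 2 =
        R (∑ p ∈ Finset.range H ×ˢ Finset.range H, u (n + p.1) * conj (u (n + p.2))) +
        ((-2 : ℝ) • L (∑ a ∈ Finset.range H, u (n + a)) + ‖s‖ ^ 2) := by
      intro n
      simp only [Finset.sum_product]
      rw [← Finset.sum_mul_sum, ← map_sum, hL]
      generalize (∑ a ∈ Finset.range H, u (n + a)) = w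
      simp only [hR, reCLM_apply, ← Complex.normSq_eq_norm_sq, Complex.normSq_apply, smul_eq_mul]
      simp
      ring
    have hbR : ∀ n, ‖R (∑ p ∈ Finset.range H ×ˢ Finset.range H,
        u (n + p.1) * conj (u (n + p.2)))‖ ≤ ‖R‖ * (H * H) := fun n => R.le_opNorm_of_le (hbP n)
    have hbL : ∀ n, ‖((-2 : ℝ) • L) (∑ a ∈ Finset.range H, u (n + a))‖ ≤
        ‖(-2 : ℝ) • L‖ * H := fun n => ((-2 : ℝ) • L).le_opNorm_of_le (hbS n)
    have hbL' : ∀ n, ‖((-2 : ℝ) • L) (∑ a ∈ Finset.range H, u (n + a)) + ‖s‖ ^ 2‖ ≤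
        ‖(-2 : ℝ) • L‖ * H + ‖s‖ ^ 2 := fun n =>
      (norm_add_le _ _).trans (add_le_add (hbL n) (by simp))
    have hpos : 0 ≤ mean (fun n => ‖(∑ a ∈ Finset.range H, u (n + a)) - s‖ ^ 2) := by
      refine mean_nonneg (C := (H + ‖s‖) ^ 2) (fun n => ?_) fun n => by positivity
      rw [Real.norm_of_nonneg (by positivity)]
      gcongr
      exact (norm_sub_le _ _).trans (add_le_add (hbS n) le_rfl)
    have hmean : mean (fun n => ‖(∑ a ∈ Finset.range H, u (n + a)) - s‖ ^ 2) =
        R (∑ a ∈ Finset.range H, mean (fun n => u (n + a) * conj (u (n + a)))) +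
        (-2 * L (H * z) + ‖s‖ ^ 2) := by
      simp_rw [hid]
      change mean (fun n => R _ + (((-2 : ℝ) • L) _ + ‖s‖ ^ 2)) = _
      rw [mean_add hbR hbL', mean_map R hbP, e1]
      congr 1
      have := mean_add hbL (v := fun _ => ‖s‖ ^ 2) (D := ‖s‖ ^ 2) (by simp)
      rw [mean_const, mean_map _ hbS, e2] at this
      simpa using this
    have hdiag : R (∑ a ∈ Finset.range H, mean (fun n => u (n + a) * conj (u (n + a)))) ≤ H := by
      rw [map_sum]
      refine (Finset.sum_le_sum (g := fun _ => (1 : ℝ)) fun a _ => ?_).trans (by simp)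
      exact (Complex.re_le_norm _).trans (norm_mean_le fun n => hcorr a a n)
    have hLz : L (H * z) = H ^ 2 * ‖z‖ ^ 2 := by
      rw [hL, hs, ← Complex.normSq_eq_conj_mul_self, Complex.ofReal_re,
        Complex.normSq_eq_norm_sq]
      simp [mul_pow]
    have hsn : ‖s‖ ^ 2 = H ^ 2 * ‖z‖ ^ 2 := by simp [hs, mul_pow]
    rw [hmean, hLz, hsn] at hpos
    have hH' : (0 : ℝ) < H := by exact_mod_cast hH
    have : (H : ℝ) * (H * ‖z‖ ^ 2) ≤ H * 1 := by nlinarith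
    exact le_of_mul_le_mul_left this hH'
  by_contra hne
  have hz0 : 0 < ‖z‖ ^ 2 := by positivity
  obtain ⟨H, hH⟩ := exists_nat_gt (1 / ‖z‖ ^ 2)
  have hHpos : 0 < H := by
    have : (0 : ℝ) < H := lt_trans (by positivity) hH
    exact_mod_cast this
  have := key H hHpos
  rw [div_lt_iff₀ hz0] at hH
  linarith

end Weyl

/-! ### Weyl equidistribution on the circle -/

section Weyl

open Complex ComplexConjugate

lemma fourier_add_right (j : ℤ) (x y : UnitAddCircle) :
    fourier j (x + y) = fourier j x * fourier j y := by
  simp [fourier_apply, smul_add, AddCircle.toCircle_add]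

lemma fourier_mul_conj (j : ℤ) (x y : UnitAddCircle) :
    fourier j x * conj (fourier j y) = fourier j (x - y) := by
  rw [← fourier_neg, sub_eq_add_neg, fourier_add_right]
  congr 1
  simp [fourier_apply]

lemma norm_fourier_apply (j : ℤ) (x : UnitAddCircle) : ‖fourier j x‖ = 1 := by
  rw [fourier_apply]; exact Circle.norm_coe _

lemma iterate_fwdDiff_add_nat {T : Type*} [AddCommGroup T] {f : ℤ → T} {k : ℕ} {c : T}
    (hf : (fwdDiff 1)^[k + 1] f = fun _ => c) (h : ℕ) (n : ℤ) :
    (fwdDiff 1)^[k] f (n + h) - (fwdDiff 1)^[k] f n = h • c := by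
  induction h with
  | zero => simp
  | succ h ih =>
    have h1 := congrFun hf (n + h)
    rw [Function.iterate_succ_apply', fwdDiff] at h1
    push_cast
    rw [add_smul, one_smul, ← ih, ← h1, add_assoc]
    abel

/-- Weyl sums of a polynomial sequence whose top difference is not torsion vanish. -/
lemma mean_fourier_eq_zero (k : ℕ) : ∀ (f : ℤ → UnitAddCircle) (c : UnitAddCircle),
    (fwdDiff 1)^[k + 1] f = (fun _ => c) → (∀ m : ℕ, m ≠ 0 → m • c ≠ 0) → ∀ j : ℤ, j ≠ 0 →
    mean (fun n : ℕ => (fourier j (f n) : ℂ)) = 0 := by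
  induction k with
  | zero =>
    intro f c hf hc j hj
    have hb : ∀ n : ℕ, ‖(fourier j (f n) : ℂ)‖ ≤ 1 := fun n => (norm_fourier_apply _ _).le
    -- The shift multiplies the sequence by the fixed phase `fourier j c`, which is not `1` because
    -- `c` is not torsion; an invariant mean must then vanish.
    have h1 := mean_shift hb
    have h2 : ∀ n : ℕ, (fourier j (f (n + 1 : ℕ)) : ℂ) =
        (ContinuousLinearMap.mul ℝ ℂ) (fourier j c) (fourier j (f n)) := by
      intro n
      have h3 := congrFun hf n
      simp only [zero_add, Function.iterate_one, fwdDiff, sub_eq_iff_eq_add] at h3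
      push_cast
      rw [h3, fourier_add_right]
      rfl
    simp_rw [h2] at h1
    rw [mean_map _ hb] at h1
    by_contra hne
    have h3 : (fourier j c : ℂ) = 1 := by
      have h4 : (fourier j c : ℂ) * mean (fun n : ℕ => (fourier j (f n) : ℂ)) =
        1 * mean (fun n : ℕ => (fourier j (f n) : ℂ)) := by rw [one_mul]; exact h1
      exact mul_right_cancel₀ hne h4
    rw [fourier_apply, Circle.coe_eq_one, ← AddCircle.toCircle_zero (T := (1 : ℝ))] at h3
    have h5 := AddCircle.injective_toCircle one_ne_zero h3
    refine hc j.natAbs (by simpa using hj) ?_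
    rcases Int.natAbs_eq j with h | h
    · rw [h, natCast_zsmul] at h5; exact h5
    · rw [h, neg_smul, natCast_zsmul, neg_eq_zero] at h5; exact h5
  | succ k ih =>
    intro f c hf hc j hj
    -- The correlation at lag `h` is the Weyl sum of `f (n + h) - f n`, of one degree less, with top
    -- difference `h • c`, still non-torsion.
    refine mean_eq_zero_of_correlations (fun n => (norm_fourier_apply _ _).le) fun h hh => ?_
    have := ih (fun n => f (n + h) - f n) (h • c) ?_ ?_ j hj
    · rw [← this]
      congr 1; ext n
      rw [fourier_mul_conj]; push_cast; rfl
    · ext n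
      have h1 : (fwdDiff 1)^[k + 1] (fun n => f (n + h) - f n) =
          (fwdDiff 1)^[k + 1] (fun n => f (n + h)) - (fwdDiff 1)^[k + 1] f := by
        rw [← fwdDiff_aux.coe_fwdDiffₗ_pow, ← map_sub]; rfl
      rw [h1, Pi.sub_apply, fwdDiff_iter_comp_add]
      exact iterate_fwdDiff_add_nat hf h n
    · intro m hm
      rw [smul_smul]
      exact hc _ (mul_ne_zero hm hh.ne')

/-- **Weyl's density theorem**: a polynomial sequence in the circle whose top difference is not
torsion meets every nonempty open set. -/
lemma exists_mem_open_of_iterate_fwdDiff {k : ℕ} {f : ℤ → UnitAddCircle} {c : UnitAddCircle}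
    (hf : (fwdDiff 1)^[k + 1] f = fun _ => c) (hc : ∀ m : ℕ, m ≠ 0 → m • c ≠ 0)
    {U : Set UnitAddCircle} (hU : IsOpen U) (hne : U.Nonempty) : ∃ n : ℤ, f n ∈ U := by
  by_contra! hcon
  obtain ⟨p, hp⟩ := hne
  obtain ⟨g, hg0, hg1, hg⟩ := exists_continuous_zero_one_of_isClosed
    (isClosed_compl_iff.mpr hU) (isClosed_singleton (x := p))
    (Set.disjoint_singleton_right.mpr fun h => h hp)
  let μ := AddCircle.haarAddCircle (T := (1 : ℝ))
  have hpos : 0 < ∫ x, g x ∂μ := by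
    refine g.continuous.integral_pos_of_hasCompactSupport_nonneg_nonzero
      (HasCompactSupport.of_compactSpace _) (fun x => (hg x).1) (x := p) ?_
    rw [hg1 rfl]; exact one_ne_zero
  let G : C(UnitAddCircle, ℂ) := ⟨fun x => (g x : ℂ), by fun_prop⟩
  have hint : ∀ P : C(UnitAddCircle, ℂ), MeasureTheory.Integrable P μ := fun P =>
    P.continuous.integrable_of_hasCompactSupport (HasCompactSupport.of_compactSpace _)
  have hbd : ∀ (P : C(UnitAddCircle, ℂ)) (n : ℕ), ‖P (f n)‖ ≤ ‖P‖ := fun P n => P.norm_coe_le_norm _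
  have hspan : ∀ P ∈ Submodule.span ℂ (Set.range (fourier (T := (1 : ℝ)))),
      mean (fun n : ℕ => P (f n)) = ∫ x, P x ∂μ := by
    intro P hP
    induction hP using Submodule.span_induction with
    | mem P hP =>
      obtain ⟨j, rfl⟩ := hP
      have h1 := congrFun (fourierCoeff_fourier (T := (1 : ℝ)) j) 0
      rw [fourierCoeff] at h1
      simp only [neg_zero, fourier_zero, one_smul] at h1
      change _ = ∫ x, fourier j x ∂_
      rw [h1]
      rcases eq_or_ne j 0 with rfl | hj
      · simp [mean_const]
      · rw [mean_fourier_eq_zero k f c hf hc j hj, Pi.single_eq_of_ne hj.symm]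
    | zero => simp [mean_const]
    | add P R _ _ hP hR =>
      simp only [ContinuousMap.add_apply]
      rw [mean_add (hbd P) (hbd R), hP, hR, MeasureTheory.integral_add (hint P) (hint R)]
    | smul a P _ hP =>
      have := mean_map (ContinuousLinearMap.mul ℝ ℂ a) (hbd P)
      simp only [ContinuousLinearMap.mul_apply'] at this
      simp only [ContinuousMap.smul_apply, smul_eq_mul]
      rw [this, hP, MeasureTheory.integral_const_mul]
  have hG0 : ∀ n : ℕ, G (f n) = 0 := fun n => by
    have : g (f n) = 0 := hg0 (hcon n)
    simp [G, this]
  have hGint : ∫ x, G x ∂μ = ((∫ x, g x ∂μ : ℝ) : ℂ) := integral_ofReal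
  -- The mean of `P` along the sequence is its integral, while `G` vanishes along the sequence. An
  -- error below half of `∫ g` gives `∫ g ≤ 2 ‖G - P‖ < ∫ g`.
  obtain ⟨P, hP, hPG⟩ := Metric.mem_closure_iff.mp
    (show G ∈ closure (Submodule.span ℂ (Set.range (fourier (T := (1 : ℝ)))) :
        Set C(UnitAddCircle, ℂ)) by
      rw [← Submodule.topologicalClosure_coe, span_fourier_closure_eq_top]; trivial)
    ((∫ x, g x ∂μ) / 2) (by positivity)
  rw [dist_eq_norm] at hPG
  have h1 : ‖(∫ x, G x ∂μ) - ∫ x, P x ∂μ‖ ≤ ‖G - P‖ := by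
    rw [← MeasureTheory.integral_sub (hint G) (hint P)]
    refine (MeasureTheory.norm_integral_le_of_norm_le_const (C := ‖G - P‖)
      (Eventually.of_forall fun x => (G - P).norm_coe_le_norm x)).trans ?_
    simp [μ]
  have h2 : ‖∫ x, P x ∂μ‖ ≤ ‖G - P‖ := by
    rw [← hspan P hP]
    refine norm_mean_le fun n => ?_
    have := (G - P).norm_coe_le_norm (f n)
    rw [ContinuousMap.sub_apply, hG0, zero_sub, norm_neg] at this
    exact this
  have h3 : ‖∫ x, G x ∂μ‖ = ∫ x, g x ∂μ := by
    rw [hGint, Complex.norm_real, Real.norm_of_nonneg hpos.le]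
  have h4 := norm_sub_norm_le (∫ x, G x ∂μ) (∫ x, P x ∂μ)
  linarith

end Weyl

/-! ### Polynomial sequences in abelian groups -/

section PolynomialSequences

variable {T : Type*} [AddCommGroup T]

lemma iterate_fwdDiff_sum {M κ : Type*} [AddCommMonoid M] (t : M) (s : Finset κ) (f : κ → M → T)
    (k : ℕ) : (fwdDiff t)^[k] (fun x => ∑ i ∈ s, f i x) =
      fun x => ∑ i ∈ s, (fwdDiff t)^[k] (f i) x := by
  have h : (fun x => ∑ i ∈ s, f i x) = ∑ i ∈ s, f i := by ext x; simp
  rw [h, fwdDiff_iter_finsetSum]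
  ext x
  simp

/-- A step of length `D` is a sum of `D` unit steps, so each difference contributes a factor `D`. -/
lemma iterate_fwdDiff_comp_affine (D : ℕ) (k : ℕ) : ∀ (f : ℤ → T) (c : T) (a : ℤ),
    (fwdDiff 1)^[k] f = (fun _ => c) →
    (fwdDiff 1)^[k] (fun n => f (a + D * n)) = fun _ => (D ^ k) • c := by
  induction k with
  | zero => intro f c a hf; simp at hf ⊢; simp [hf]
  | succ k ih =>
    intro f c a hf
    rw [Function.iterate_succ_apply] at hf ⊢
    have h1 : fwdDiff 1 (fun n => f (a + D * n)) =
        fun n => ∑ i ∈ Finset.range D, fwdDiff 1 f (a + i + D * n) := by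
      ext n
      have := Finset.sum_range_sub (fun i : ℕ => f (a + i + D * n)) D
      simp only [fwdDiff]
      rw [Nat.cast_zero, add_zero] at this
      convert this.symm using 3
      · ring
      · push_cast; ring_nf
    rw [h1, iterate_fwdDiff_sum]
    ext n
    simp_rw [ih _ _ _ hf]
    rw [Finset.sum_const, Finset.card_range, smul_smul, pow_succ']

/-- After passing to the residue classes of a suitable modulus, or any multiple of it, a polynomial
sequence is either constant or has a non-torsion top difference of positive order. -/
lemma exists_modulus_const_or_nontorsion (k : ℕ) : ∀ f : ℤ → T,
    (fwdDiff 1)^[k] f = (fun _ => 0) → ∃ D : ℕ, 0 < D ∧ ∀ D' : ℕ, 0 < D' → D ∣ D' → ∀ a : ℤ,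
      (∀ n, f (a + D' * n) = f a) ∨ ∃ (l : ℕ) (c : T), (∀ m : ℕ, m ≠ 0 → m • c ≠ 0) ∧
        (fwdDiff 1)^[l + 1] (fun n => f (a + D' * n)) = fun _ => c := by
  induction k with
  | zero =>
    intro f hf
    simp only [Function.iterate_zero, id] at hf
    exact ⟨1, one_pos, fun D' _ _ a => Or.inl fun n => by simp [hf]⟩
  | succ k ih =>
    intro f hf
    set c := (fwdDiff 1)^[k] f 0 with hc
    have hconst : (fwdDiff 1)^[k] f = fun _ => c := by
      ext n
      have hs : ∀ n, (fwdDiff 1)^[k] f (n + 1) = (fwdDiff 1)^[k] f n := fun n => by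
        have := congrFun hf n
        rw [Function.iterate_succ_apply', fwdDiff, sub_eq_zero] at this
        exact this
      induction n using Int.induction_on with
      | zero => rfl
      | succ n ihn => rw [hs, ihn]
      | pred n ihn => rw [← ihn, ← hs, sub_add_cancel]
    rcases Nat.eq_zero_or_pos k with rfl | hk
    · simp only [Function.iterate_zero, id] at hconst
      exact ⟨1, one_pos, fun D' _ _ a => Or.inl fun n => by simp [hconst]⟩
    by_cases ht : ∀ m : ℕ, m ≠ 0 → m • c ≠ 0
    · refine ⟨1, one_pos, fun D' hD' _ a => Or.inr ⟨k - 1, D' ^ k • c, ?_, ?_⟩⟩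
      · intro m hm
        rw [smul_smul]
        exact ht _ (mul_ne_zero hm (pow_ne_zero _ hD'.ne'))
      · rw [Nat.sub_add_cancel hk]
        exact iterate_fwdDiff_comp_affine D' k f c a hconst
    -- If `m • c = 0`, restricting to a class modulo `m` multiplies the top difference by `m ^ k`,
    -- which kills it as `k > 0`. The degree drops in each of the `m` classes, and their moduli are
    -- multiplied together.
    · push Not at ht
      obtain ⟨m, hm, hmc⟩ := ht
      have hmpos : 0 < m := Nat.pos_of_ne_zero hm
      have hz : ∀ a : ℤ, (fwdDiff 1)^[k] (fun n => f (a + m * n)) = fun _ => 0 := fun a => by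
        rw [iterate_fwdDiff_comp_affine m k f c a hconst]
        ext n
        obtain ⟨k, rfl⟩ := Nat.exists_eq_succ_of_ne_zero hk.ne'
        rw [Nat.succ_eq_add_one, pow_succ, mul_smul, hmc, smul_zero]
      choose D hD0 hD using fun a => ih _ (hz a)
      refine ⟨m * ∏ a ∈ Finset.range m, D a, Nat.mul_pos hmpos (Finset.prod_pos fun a _ => hD0 a),
        fun D' hD' hdvd a => ?_⟩
      obtain ⟨e, rfl⟩ := (Dvd.intro _ rfl).trans hdvd
      have hmz : (m : ℤ) ≠ 0 := by exact_mod_cast hm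
      have hr : ((a % m).toNat : ℤ) = a % m := Int.toNat_of_nonneg (Int.emod_nonneg _ hmz)
      have hlt : (a % m).toNat < m := by
        have := Int.emod_lt_of_pos a (show (0 : ℤ) < m by exact_mod_cast hmpos)
        omega
      have he : 0 < e := Nat.pos_of_mul_pos_left hD'
      have hdiv : D (a % m).toNat ∣ e :=
        (Finset.dvd_prod_of_mem (fun a : ℕ => D a) (Finset.mem_range.mpr hlt)).trans
          (Nat.dvd_of_mul_dvd_mul_left hmpos hdvd)
      have heq : ∀ n : ℤ, a + ((m * e : ℕ) : ℤ) * n = (a % m).toNat + m * (a / m + e * n) := by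
        intro n
        rw [hr]
        have := Int.emod_add_mul_ediv a m
        push_cast
        linear_combination -this
      have heq0 : a = (a % m).toNat + m * (a / m) := by
        rw [hr]; exact (Int.emod_add_mul_ediv a m).symm
      rcases hD _ e he hdiv (a / m) with h | ⟨l, c', h1, h2⟩
      · left; intro n
        rw [heq, h n]
        exact congrArg f heq0.symm
      · right
        refine ⟨l, c', h1, ?_⟩
        rw [← h2]
        congr 1; ext n; rw [heq]

/-- A bounded real polynomial sequence is constant. -/
lemma eq_of_iterate_fwdDiff_eq_zero_of_bounded {u : ℤ → ℝ} {C : ℝ} (hu : ∀ n, |u n| ≤ C) (k : ℕ)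
    (hk : (fwdDiff 1)^[k + 1] u = fun _ => 0) : ∀ n, u (n + 1) = u n := by
  have hbound : ∀ k, ∃ C, ∀ n, |(fwdDiff 1)^[k] u n| ≤ C := by
    intro k
    induction k with
    | zero => exact ⟨C, hu⟩
    | succ k ih =>
      obtain ⟨C, hC⟩ := ih
      refine ⟨C + C, fun n => ?_⟩
      rw [Function.iterate_succ_apply', fwdDiff]
      exact (abs_sub _ _).trans (add_le_add (hC _) (hC _))
  induction k with
  | zero =>
    intro n
    have := congrFun hk n
    simp only [zero_add, Function.iterate_one, fwdDiff] at this
    linarith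
  | succ k ih =>
    apply ih
    have hs : ∀ n, (fwdDiff 1)^[k + 1] u (n + 1) = (fwdDiff 1)^[k + 1] u n := fun n => by
      have := congrFun hk n
      rw [Function.iterate_succ_apply', fwdDiff, sub_eq_zero] at this
      exact this
    have hconst : (fwdDiff 1)^[k + 1] u = fun _ => (fwdDiff 1)^[k + 1] u 0 := by
      ext n
      induction n using Int.induction_on with
      | zero => rfl
      | succ n ihn => rw [hs, ihn]
      | pred n ihn => rw [← ihn, ← hs, sub_add_cancel]
    set c := (fwdDiff 1)^[k + 1] u 0 with hc
    obtain ⟨C, hC⟩ := hbound k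
    -- Otherwise the previous difference grows linearly, against its bound.
    have hc0 : c = 0 := by
      by_contra hne
      obtain ⟨h, hh⟩ := exists_nat_gt ((C + C) / |c|)
      rw [div_lt_iff₀ (abs_pos.mpr hne)] at hh
      have h1 := iterate_fwdDiff_add_nat hconst h 0
      have h2 := (abs_sub ((fwdDiff 1)^[k] u (0 + h)) ((fwdDiff 1)^[k] u 0)).trans
        (add_le_add (hC _) (hC _))
      rw [h1, nsmul_eq_mul, abs_mul, Nat.abs_cast] at h2
      linarith
    rw [hconst, hc0]

end PolynomialSequences

/-! ### The dilation lemma -/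

section Dilation

variable {G : Type*} [AddCommGroup G]

/-- The translation action of a group on functions, as a homomorphism to linear endomorphisms. -/
def translation (R : Type*) [CommRing R] : Multiplicative G →* Module.End R (G → R) where
  toFun g := LinearMap.funLeft R R fun x => x - g.toAdd
  map_one' := by ext; simp [LinearMap.funLeft_apply]
  map_mul' g h := by
    refine LinearMap.ext fun φ => funext fun x => ?_
    simp only [Module.End.mul_apply, LinearMap.funLeft_apply, toAdd_mul]
    congr 1; abel

/-- In the group algebra over `ZMod p`, Frobenius turns `(∑ δ_{f i}) ^ p` into `∑ δ_{p f i}`. One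
factor sends `a` to the constant `1`; the other `p - 1` multiply it by `s.card ^ (p - 1) = 1`. So
the count is `1` modulo `p`, and it is at most `s.card < p`. -/
lemma sum_translate_prime_smul {κ : Type*} (s : Finset κ) (f : κ → G) {a : G → ℕ}
    (ha : ∀ x, a x ≤ 1) (h : ∀ x, ∑ i ∈ s, a (x - f i) = 1) {p : ℕ} (hp : p.Prime)
    (hs : s.card < p) (x : G) : ∑ i ∈ s, a (x - p • f i) = 1 := by
  have : Fact p.Prime := ⟨hp⟩
  let Θ : AddMonoidAlgebra (ZMod p) G →ₐ[ZMod p] Module.End (ZMod p) (G → ZMod p) :=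
    AddMonoidAlgebra.lift _ _ _ (translation (ZMod p))
  have hΘ : ∀ (g : G) (φ : G → ZMod p) (x : G),
      Θ (AddMonoidAlgebra.single g 1) φ x = φ (x - g) := by
    intro g φ x
    simp [Θ, translation, LinearMap.funLeft_apply]
  let P : AddMonoidAlgebra (ZMod p) G := ∑ i ∈ s, AddMonoidAlgebra.single (f i) 1
  have hP : ∀ (φ : G → ZMod p), Θ P φ = fun x => ∑ i ∈ s, φ (x - f i) := by
    intro φ; ext x
    simp only [P, map_sum, LinearMap.sum_apply, Finset.sum_apply, hΘ]
  have hPp : P ^ p = ∑ i ∈ s, AddMonoidAlgebra.single (p • f i) 1 := by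
    have : CharP (AddMonoidAlgebra (ZMod p) G) p :=
      charP_of_injective_algebraMap (algebraMap (ZMod p) _).injective p
    rw [sum_pow_char p]
    refine Finset.sum_congr rfl fun i _ => ?_
    rw [AddMonoidAlgebra.single_pow, one_pow]
  have hpos : 0 < s.card := by
    rw [Finset.card_pos]
    by_contra hne
    rw [Finset.not_nonempty_iff_eq_empty] at hne
    simpa [hne] using h 0
  have hcard : (s.card : ZMod p) ≠ 0 := by
    rw [Ne, ZMod.natCast_eq_zero_iff]
    exact fun hd => absurd (Nat.le_of_dvd hpos hd) (by omega)
  have h1 : Θ P (fun x => (a x : ZMod p)) = fun _ => 1 := by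
    rw [hP]; ext x
    exact_mod_cast congrArg (Nat.cast : ℕ → ZMod p) (h x)
  have hc : ∀ n : ℕ, (Θ P ^ n) (fun _ => (1 : ZMod p)) = fun _ => (s.card : ZMod p) ^ n := by
    intro n
    induction n with
    | zero => simp
    | succ n ih =>
      rw [pow_succ', Module.End.mul_apply, ih, hP]
      ext x
      rw [Finset.sum_const, nsmul_eq_mul, pow_succ']
  have h2 : Θ (P ^ p) (fun x => (a x : ZMod p)) = fun _ => 1 := by
    rw [map_pow, ← pow_sub_one_mul hp.ne_zero, Module.End.mul_apply, h1, hc]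
    ext x
    simpa using ZMod.pow_card_sub_one_eq_one hcard
  have h3 : ((∑ i ∈ s, a (x - p • f i) : ℕ) : ZMod p) = (1 : ℕ) := by
    have := congrFun h2 x
    rw [hPp] at this
    simp only [map_sum, LinearMap.sum_apply, Finset.sum_apply, hΘ] at this
    push_cast; exact this
  rw [ZMod.natCast_eq_natCast_iff] at h3
  refine h3.eq_of_lt_of_lt (lt_of_le_of_lt ?_ hs) hp.one_lt
  exact (Finset.sum_le_sum fun i _ => ha _).trans (by simp)

/-- **The dilation lemma**: a tiling by `f` is also a tiling by `r • f`, if all prime factors of `r`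
exceed the size of the tile. -/
lemma sum_translate_smul {κ : Type*} (s : Finset κ) {a : G → ℕ} (ha : ∀ x, a x ≤ 1) (r : ℕ) :
    r ≠ 0 → (∀ p : ℕ, p.Prime → p ∣ r → s.card < p) → ∀ f : κ → G,
    (∀ x, ∑ i ∈ s, a (x - f i) = 1) → ∀ x, ∑ i ∈ s, a (x - r • f i) = 1 := by
  induction r using Nat.recOnMul with
  | zero => intro h; exact absurd rfl h
  | one => intro _ _ f h; simpa using h
  | prime p hp =>
    intro _ hs f h
    exact sum_translate_prime_smul s f ha h hp (hs p hp dvd_rfl)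
  | mul m n ihm ihn =>
    intro h0 hs f h
    simp_rw [mul_smul]
    exact ihm (left_ne_zero_of_mul h0) (fun p hp hd => hs p hp (hd.mul_right n)) (fun i => n • f i)
      (ihn (right_ne_zero_of_mul h0) (fun p hp hd => hs p hp (hd.mul_left m)) f h)

/-- Primes up to `s.card` divide `Q`, hence none of them divides `1 + Q n`. -/
lemma sum_translate_one_add_mul_smul {κ : Type*} (s : Finset κ) {a : G → ℕ} (ha : ∀ x, a x ≤ 1)
    (f : κ → G) (h : ∀ x, ∑ i ∈ s, a (x - f i) = 1) {Q : ℕ} (hQ : s.card.factorial ∣ Q) (n : ℕ)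
    (x : G) : ∑ i ∈ s, a (x - (1 + Q * n) • f i) = 1 := by
  refine sum_translate_smul s ha _ (by omega) (fun p hp hd => ?_) f h x
  by_contra hle
  have h1 : p ∣ Q * n := ((hp.dvd_factorial.mpr (not_lt.mp hle)).trans hQ).mul_right n
  exact hp.one_lt.ne' (Nat.dvd_one.mp ((Nat.dvd_add_left h1).mp hd))

end Dilation

/-! ### Averaging over dilates -/

section Averages

variable {G : Type*} [AddCommGroup G]

/-- Average of `φ` along the arithmetic progression of vectors `(1 + Q n) g`. -/
noncomputable def avg (Q : ℕ) (g : G) (φ : G → ℝ) (x : G) : ℝ :=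
  mean fun n => φ (x - (1 + Q * n) • g)

/-- `φ` is a `[0, 1]`-valued weight that tiles with all the dilates `(1 + Q n) F i`, `i < K`. -/
def IsTiled (F : ℕ → Finset G) (K Q : ℕ) (φ : G → ℝ) : Prop :=
  (∀ x, 0 ≤ φ x ∧ φ x ≤ 1) ∧ ∀ i < K, ∀ n : ℕ, ∀ x, ∑ g ∈ F i, φ (x - (1 + Q * n) • g) = 1

variable {F : ℕ → Finset G} {K Q : ℕ} {φ : G → ℝ}

lemma norm_le_one_of_mem {t : ℝ} (h : 0 ≤ t ∧ t ≤ 1) : ‖t‖ ≤ 1 := by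
  rw [Real.norm_of_nonneg h.1]; exact h.2

lemma avg_mem (h : ∀ x, 0 ≤ φ x ∧ φ x ≤ 1) (g x : G) : 0 ≤ avg Q g φ x ∧ avg Q g φ x ≤ 1 :=
  ⟨mean_nonneg (fun _ => norm_le_one_of_mem (h _)) fun _ => (h _).1,
    (le_abs_self _).trans (norm_mean_le fun _ => norm_le_one_of_mem (h _))⟩

/-- Translating by `Q • g` shifts the index of the progression by one. -/
lemma avg_sub_smul (h : ∀ x, 0 ≤ φ x ∧ φ x ≤ 1) (g x : G) :
    avg Q g φ (x - Q • g) = avg Q g φ x := by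
  rw [avg, avg, ← mean_shift (u := fun n => φ (x - (1 + Q * n) • g))
    fun _ => norm_le_one_of_mem (h _)]
  congr 1; ext n; congr 1
  rw [sub_sub, ← add_smul]
  congr 2; ring

lemma avg_add_of_invariant {t : G} (h : ∀ x, φ (x + t) = φ x) (g x : G) :
    avg Q g φ (x + t) = avg Q g φ x := by
  unfold avg
  congr 1; ext n
  rw [← h (x - _)]
  congr 1; abel

lemma IsTiled.avg (h : IsTiled F K Q φ) (g : G) : IsTiled F K Q (avg Q g φ) := by
  refine ⟨avg_mem h.1 g, fun i hi n x => ?_⟩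
  unfold JointTiling.avg
  rw [← mean_sum (C := 1) (F i) fun _ _ _ => norm_le_one_of_mem (h.1 _), ← mean_const (1 : ℝ)]
  congr 1; ext m
  rw [← h.2 i hi n (x - (1 + Q * m) • g)]
  refine Finset.sum_congr rfl fun k _ => ?_
  congr 1; abel

/-- For each `n` the term at `0` in the dilated tiling equation is `φ x`, independent of `n`;
average the other terms. -/
lemma IsTiled.eq_one_sub_sum_avg [DecidableEq G] (h : IsTiled F K Q φ) {i : ℕ} (hi : i < K)
    (h0 : 0 ∈ F i) (x : G) : φ x = 1 - ∑ g ∈ (F i).erase 0, JointTiling.avg Q g φ x := by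
  unfold JointTiling.avg
  rw [← mean_sum (C := 1) _ fun _ _ _ => norm_le_one_of_mem (h.1 _)]
  have h1 : ∀ n : ℕ, ∑ g ∈ (F i).erase 0, φ (x - (1 + Q * n) • g) = 1 - φ x := by
    intro n
    have := h.2 i hi n x
    rw [← Finset.add_sum_erase _ _ h0, smul_zero, sub_zero] at this
    linarith
  simp_rw [h1, mean_const]
  ring

/-- Iterated averages along the vectors `v 0, v 1, …, v (k - 1)`. -/
noncomputable def iterAvg (Q : ℕ) (φ : G → ℝ) (v : ℕ → G) : ℕ → G → ℝ
  | 0 => φ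
  | k + 1 => avg Q (v k) (iterAvg Q φ v k)

lemma IsTiled.iterAvg (h : IsTiled F K Q φ) (v : ℕ → G) (k : ℕ) :
    IsTiled F K Q (iterAvg Q φ v k) := by
  induction k with
  | zero => exact h
  | succ k ih => exact ih.avg _

lemma iterAvg_congr {v w : ℕ → G} {k : ℕ} (h : ∀ i < k, v i = w i) :
    iterAvg Q φ v k = iterAvg Q φ w k := by
  induction k with
  | zero => rfl
  | succ k ih =>
    rw [iterAvg, iterAvg, h k (Nat.lt_succ_self k), ih fun i hi => h i (hi.trans (Nat.lt_succ_self k))]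

lemma iterAvg_add_smul (h : ∀ x, 0 ≤ φ x ∧ φ x ≤ 1) (v : ℕ → G) (k : ℕ) :
    ∀ i < k, ∀ x, iterAvg Q φ v k (x + Q • v i) = iterAvg Q φ v k x := by
  have hb : ∀ k, ∀ x, 0 ≤ iterAvg Q φ v k x ∧ iterAvg Q φ v k x ≤ 1 := by
    intro k
    induction k with
    | zero => exact h
    | succ k ih => exact avg_mem ih _
  induction k with
  | zero => intro i hi; omega
  | succ k ih =>
    intro i hi x
    rcases Nat.lt_succ_iff_lt_or_eq.mp hi with hi | rfl
    · exact avg_add_of_invariant (ih i hi) _ x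
    · have := avg_sub_smul (Q := Q) (hb i) (v i) (x + Q • v i)
      rw [add_sub_cancel_right] at this
      exact this.symm

/-- A function invariant under `Q v_i` for all `i` is invariant under the subgroup they generate. -/
lemma add_eq_of_invariant {T κ : Type*} {f : G → T} {Q : ℕ} (s : Finset κ) (v : κ → G)
    (h : ∀ i ∈ s, ∀ x, f (x + Q • v i) = f x) (c : κ → ℤ) (x : G) :
    f (x + Q • ∑ i ∈ s, c i • v i) = f x := by
  let H : AddSubgroup G :=
    { carrier := {t | ∀ x, f (x + t) = f x}
      zero_mem' := fun x => by rw [add_zero]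
      add_mem' := fun {a b} ha hb x => by rw [← add_assoc, hb, ha]
      neg_mem' := fun {a} ha x => by rw [← ha (x + -a), neg_add_cancel_right] }
  have : Q • ∑ i ∈ s, c i • v i ∈ H := by
    rw [Finset.smul_sum]
    refine H.sum_mem fun i hi => ?_
    rw [smul_comm]
    exact H.zsmul_mem (h i hi) _
  exact this x

end Averages

/-! ### Polynomiality modulo one and the constant-or-spread dichotomy -/

section Spread

variable {G : Type*} [AddCommGroup G]

lemma iterate_fwdDiff_comp_line {T : Type*} [AddCommGroup T] (f : G → T) (x t : G) (k : ℕ) :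
    (fwdDiff 1)^[k] (fun n : ℤ => f (x + n • t)) = fun n => (fwdDiff t)^[k] f (x + n • t) := by
  induction k with
  | zero => rfl
  | succ k ih =>
    rw [Function.iterate_succ_apply', Function.iterate_succ_apply', ih]
    ext n
    simp only [fwdDiff, add_smul, one_smul, add_assoc]

/-- If a sum of functions is constant, and for each `j` the vector `t` splits as an invariance
vector of `f j` plus one of `f₀`, then `f₀` is polynomial in direction `t`. -/
lemma iterate_fwdDiff_eq_zero_of_sum_const {κ T : Type*} [AddCommGroup T] (S : Finset κ) (t : G)
    (a : κ → G) : ∀ (f₀ : G → T) (f : κ → G → T), (∀ j ∈ S, ∀ x, f₀ (x + (t - a j)) = f₀ x) →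
    (∀ j ∈ S, ∀ x, f j (x + a j) = f j x) →
    (∀ x y, f₀ x + ∑ j ∈ S, f j x = f₀ y + ∑ j ∈ S, f j y) →
    (fwdDiff t)^[S.card + 1] f₀ = fun _ => 0 := by
  classical
  induction S using Finset.induction_on with
  | empty =>
    intro f₀ f _ _ hs
    ext x
    simpa [fwdDiff, sub_eq_zero] using hs (x + t) x
  | insert j S hj ih =>
    intro f₀ f h0 hf hs
    -- Differencing the whole relation along `a j` removes `f j` and acts on `f₀` like differencing
    -- along `t`.
    have hdiff : ∀ x, fwdDiff t f₀ x = fwdDiff (a j) f₀ x := by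
      intro x
      have := h0 j (Finset.mem_insert_self _ _) (x + a j)
      rw [add_assoc, add_sub_cancel] at this
      simp only [fwdDiff, this]
    rw [Finset.card_insert_of_notMem hj, Function.iterate_succ_apply]
    refine ih (fwdDiff t f₀) (fun k => fwdDiff (a j) (f k)) (fun k hk x => ?_) (fun k hk x => ?_)
      fun x y => ?_
    · have := h0 k (Finset.mem_insert_of_mem hk)
      simp only [fwdDiff]
      rw [this, add_right_comm, this]
    · have := hf k (Finset.mem_insert_of_mem hk)
      simp only [fwdDiff]
      rw [this, add_right_comm, this]
    · have hc : ∀ x, fwdDiff t f₀ x + ∑ k ∈ S, fwdDiff (a j) (f k) x = 0 := by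
        intro x
        rw [hdiff]
        simp only [fwdDiff, Finset.sum_sub_distrib]
        have h1 := hs (x + a j) x
        rw [Finset.sum_insert hj, Finset.sum_insert hj, hf j (Finset.mem_insert_self _ _)] at h1
        have h2 : f₀ (x + a j) + ∑ k ∈ S, f k (x + a j) = f₀ x + ∑ k ∈ S, f k x := by
          rw [add_left_comm, add_left_comm (f₀ x)] at h1
          exact add_left_cancel h1
        rw [sub_add_sub_comm, h2, sub_self]
      rw [hc, hc]

/-- On the coset `x + n G` the function `h` is constant, or it comes arbitrarily close to both
`0` and `1`. -/
def ConstOrSpread (n : ℕ) (h : G → ℝ) (x : G) : Prop :=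
  (∀ s, h (x + n • s) = h x) ∨
    ∀ ε > 0, (∃ s, 1 - ε < h (x + n • s)) ∧ ∃ s, h (x + n • s) < ε

/-- Every subgroup `N G` has finite index. -/
def HasFiniteQuotients (G : Type*) [AddCommGroup G] : Prop :=
  ∀ N : ℕ, 0 < N → ∃ R : Finset G, ∀ x, ∃ r ∈ R, ∃ s, x = r + N • s

lemma exists_int_of_coe_eq {a b : ℝ} (h : (a : UnitAddCircle) = b) : ∃ z : ℤ, a = b + z := by
  rw [← sub_eq_zero, ← AddCircle.coe_sub, AddCircle.coe_eq_zero_iff] at h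
  obtain ⟨z, hz⟩ := h
  exact ⟨z, by simp at hz; linarith⟩

/-- The dichotomy for the values of a function that is polynomial modulo one. -/
lemma exists_modulus_constOrSpread (hG : HasFiniteQuotients G) {l : G →+ ℤ} {e : G}
    (he : 0 < l e) {Ψ : G → ℝ} (hΨ : ∀ x, 0 ≤ Ψ x ∧ Ψ x ≤ 1) {M k : ℕ} (hM : 0 < M)
    (hinv : ∀ s, l s = 0 → ∀ x, Ψ (x + M • s) = Ψ x)
    (hpoly : ∀ t, (fwdDiff (M • t))^[k] (fun x => (Ψ x : UnitAddCircle)) = fun _ => 0) :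
    ∃ n : ℕ, 0 < n ∧ ∀ n' : ℕ, 0 < n' → n ∣ n' → ∀ x, ConstOrSpread n' Ψ x := by
  obtain ⟨E, hE⟩ := Int.eq_ofNat_of_zero_le he.le
  have hE0 : 0 < E := by omega
  obtain ⟨R, hR⟩ := hG (M * E) (by positivity)
  set t := M • e with ht
  have hseq : ∀ r : G, (fwdDiff 1)^[k] (fun n : ℤ => (Ψ (r + n • t) : UnitAddCircle)) =
      fun _ => 0 := fun r => by
    rw [iterate_fwdDiff_comp_line (fun x => (Ψ x : UnitAddCircle)), hpoly]
  choose D hD0 hD using fun r => exists_modulus_const_or_nontorsion k _ (hseq r)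
  have hPD : 0 < ∏ r ∈ R, D r := Finset.prod_pos fun r _ => hD0 r
  refine ⟨M * E * ∏ r ∈ R, D r, by positivity, fun n' hn' hdvd x => ?_⟩
  obtain ⟨b, rfl⟩ := hdvd
  have hb : 0 < b := Nat.pos_of_mul_pos_left hn'
  obtain ⟨r, hr, s₀, rfl⟩ := hR x
  set D' := (∏ r ∈ R, D r) * b with hD'
  have hD'0 : 0 < D' := by positivity
  have hdvd : D r ∣ D' := (Finset.dvd_prod_of_mem D hr).mul_right b
  -- Modulo `M • ker l` a point of the coset is determined by its value under `l`, so the coset is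
  -- read off along one line in direction `t`.
  have hline : ∀ s, Ψ (r + (M * E) • s₀ + (M * E * (∏ r ∈ R, D r) * b) • s) =
      Ψ (r + (l s₀ + D' * l s) • t) := by
    intro s
    have h1 := hinv (E • s₀ - l s₀ • e + (D' * E) • s - (D' * l s) • e) (by
      simp only [map_add, map_sub, map_nsmul, map_zsmul, hE, smul_eq_mul, nsmul_eq_mul]
      push_cast; ring) (r + (l s₀ + D' * l s) • t)
    rw [← h1]
    congr 1
    rw [ht, hD']
    module
  have hx : Ψ (r + (M * E) • s₀) = Ψ (r + (l s₀) • t) := by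
    simpa using hline 0
  rcases hD r D' hD'0 hdvd (l s₀) with hc | ⟨m, c, hc, hfc⟩
  -- Constant modulo one but not constant: two values in `[0, 1]` differ by a nonzero integer, so
  -- they are `0` and `1`.
  · by_cases hall : ∀ s, Ψ (r + (M * E) • s₀ + (M * E * (∏ r ∈ R, D r) * b) • s) =
        Ψ (r + (M * E) • s₀)
    · exact Or.inl hall
    right
    push Not at hall
    obtain ⟨s, hs⟩ := hall
    have h1 := hc (l s)
    rw [← hline, ← hx] at h1
    obtain ⟨z, hz⟩ := exists_int_of_coe_eq h1
    have b1 := hΨ (r + (M * E) • s₀)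
    have b2 := hΨ (r + (M * E) • s₀ + (M * E * (∏ r ∈ R, D r) * b) • s)
    have hzne : z ≠ 0 := fun h0 => hs (by rw [hz, h0]; simp)
    rcases lt_or_gt_of_ne hzne with hneg | hpos
    · have : (z : ℝ) ≤ -1 := by exact_mod_cast Int.le_sub_one_of_lt hneg
      intro ε hε
      refine ⟨⟨0, ?_⟩, ⟨s, ?_⟩⟩
      · rw [smul_zero, add_zero]; linarith
      · linarith
    · have : (1 : ℝ) ≤ z := by exact_mod_cast hpos
      intro ε hε
      refine ⟨⟨s, ?_⟩, ⟨0, ?_⟩⟩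
      · linarith
      · rw [smul_zero, add_zero]; linarith
  · right
    -- Multiples of `e` reach only indices divisible by `E = l e`; sparsifying by `E` keeps the top
    -- difference non-torsion.
    have hfc' := iterate_fwdDiff_comp_affine E (m + 1) _ c 0 hfc
    have hnt : ∀ q : ℕ, q ≠ 0 → q • (E ^ (m + 1) • c) ≠ 0 := fun q hq => by
      rw [smul_smul]
      exact hc _ (mul_ne_zero hq (pow_ne_zero _ hE0.ne'))
    have hhit : ∀ lo hi : ℝ, lo < hi → 0 ≤ lo → hi ≤ 1 →
        ∃ s, Ψ (r + (M * E) • s₀ + (M * E * (∏ r ∈ R, D r) * b) • s) ∈ Set.Ioo lo hi := by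
      intro lo hi hlt hlo hhi
      obtain ⟨n, y, hy, hyn⟩ := exists_mem_open_of_iterate_fwdDiff hfc' hnt
        (QuotientAddGroup.isOpenMap_coe (Set.Ioo lo hi) isOpen_Ioo)
        ((Set.nonempty_Ioo.mpr hlt).image _)
      refine ⟨n • e, ?_⟩
      rw [hline, map_zsmul, hE, smul_eq_mul, mul_comm n]
      rw [zero_add] at hyn
      obtain ⟨z, hz⟩ := exists_int_of_coe_eq hyn
      have h1 := hΨ (r + (l s₀ + D' * (E * n)) • t)
      have h2 : -1 < (z : ℝ) := by linarith [hy.1, hy.2]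
      have h3 : (z : ℝ) < 1 := by linarith [hy.1, hy.2]
      have h4 : z = 0 := by
        have h5 : -1 < z := by exact_mod_cast h2
        have h6 : z < 1 := by exact_mod_cast h3
        omega
      rw [h4, Int.cast_zero, add_zero] at hz
      rwa [← hz]
    intro ε hε
    constructor
    · obtain ⟨s, hs⟩ := hhit (1 - min ε 1) 1 (by simp [hε]) (by simp) le_rfl
      exact ⟨s, by linarith [hs.1, min_le_left ε 1]⟩
    · obtain ⟨s, hs⟩ := hhit 0 (min ε 1) (by simp [hε]) le_rfl (by simp)
      exact ⟨s, by linarith [hs.2, min_le_left ε 1]⟩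

end Spread

/-! ### Hyperplane structure passes through complements of sums -/

section Good

variable {G κ : Type*} [AddCommGroup G]

/-- On each coset `x + n G` the function `h` is constant, or for some `i ∈ S` it is invariant under
`n • ker (l i)` and on every finer coset it is constant or spread between `0` and `1`. -/
def Good (l : κ → G →+ ℤ) (n : ℕ) (S : Set κ) (h : G → ℝ) : Prop :=
  ∀ x, (∀ s, h (x + n • s) = h x) ∨ ∃ i ∈ S,
    (∀ s r, l i r = 0 → h (x + n • s + n • r) = h (x + n • s)) ∧
    ∀ m : ℕ, 0 < m → ∀ s, ConstOrSpread (n * m) h (x + n • s)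

lemma Good.mono {l : κ → G →+ ℤ} {n : ℕ} {S S' : Set κ} {h : G → ℝ} (hg : Good l n S h)
    (hS : S ⊆ S') : Good l n S' h := fun x =>
  (hg x).imp_right fun ⟨i, hi, h1⟩ => ⟨i, hS hi, h1⟩

lemma ConstOrSpread.of_eq_one_sub {n : ℕ} {h H : G → ℝ} {x : G} (hc : ConstOrSpread n h x)
    (hH : ∀ s, H (x + n • s) = 1 - h (x + n • s)) : ConstOrSpread n H x := by
  have hx : H x = 1 - h x := by simpa using hH 0
  rcases hc with hc | hc
  · exact Or.inl fun s => by rw [hH, hc, hx]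
  · refine Or.inr fun ε hε => ?_
    obtain ⟨⟨s, hs⟩, s', hs'⟩ := hc ε hε
    exact ⟨⟨s', by rw [hH]; linarith⟩, ⟨s, by rw [hH]; linarith⟩⟩

/-- On a coset at most one summand is nonconstant, since two would both approach `1` at a common
point. As that one approaches `1`, the other summands are forced to be `0`. The factor `D` enters
because only `D • t` is known to split between two kernels. -/
lemma Good.one_sub_sum {β : Type*} {l : κ → G →+ ℤ} {n D : ℕ} (hD : 0 < D) {J : Finset β}
    {h : β → G → ℝ} {S : β → Set κ}
    (hsep : ∀ j ∈ J, ∀ j' ∈ J, j ≠ j' → ∀ i ∈ S j, ∀ i' ∈ S j', ∀ t, ∃ a b,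
      l i a = 0 ∧ l i' b = 0 ∧ D • t = a + b)
    (h0 : ∀ j ∈ J, ∀ x, 0 ≤ h j x) (h1 : ∀ x, ∑ j ∈ J, h j x ≤ 1)
    (hg : ∀ j ∈ J, Good l n (S j) (h j)) :
    Good l (n * D) {i | ∃ j ∈ J, i ∈ S j} (fun x => 1 - ∑ j ∈ J, h j x) := by
  intro x
  by_cases hall : ∀ j ∈ J, ∀ s, h j (x + (n * D) • s) = h j x
  · exact Or.inl fun s => by
      beta_reduce
      rw [Finset.sum_congr rfl fun j hj => hall j hj s]
  have hspread : ∀ j ∈ J, ¬ (∀ s, h j (x + (n * D) • s) = h j x) → ∃ i ∈ S j,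
      (∀ s r, l i r = 0 → h j (x + n • s + n • r) = h j (x + n • s)) ∧
      (∀ m : ℕ, 0 < m → ∀ s, ConstOrSpread (n * m) (h j) (x + n • s)) ∧
      ∀ ε > 0, ∃ s, 1 - ε < h j (x + (n * D) • s) := by
    intro j hj hne
    rcases hg j hj x with hc | ⟨i, hi, hinv, hcs⟩
    · exact absurd (fun s => by rw [mul_smul]; exact hc _) hne
    · refine ⟨i, hi, hinv, hcs, ?_⟩
      have := hcs D hD 0
      rw [smul_zero, add_zero] at this
      rcases this with hc | hc
      · exact absurd hc hne
      · exact fun ε hε => (hc ε hε).1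
  push Not at hall
  obtain ⟨j₀, hj₀, s₀, hs₀⟩ := hall
  obtain ⟨i₀, hi₀, hinv₀, hcs₀, hsp₀⟩ := hspread j₀ hj₀ fun h => hs₀ (h s₀)
  have hpair : ∀ j ∈ J, j ≠ j₀ → ∀ y, h j₀ y + h j y ≤ 1 := by
    classical
    intro j hj hne y
    refine le_trans ?_ (h1 y)
    rw [← Finset.sum_pair (f := fun j => h j y) hne.symm]
    refine Finset.sum_le_sum_of_subset_of_nonneg ?_ fun k hk _ => h0 k hk y
    intro k hk
    rcases Finset.mem_insert.mp hk with rfl | hk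
    · exact hj₀
    · rwa [Finset.mem_singleton.mp hk]
  have hzero : ∀ j ∈ J, j ≠ j₀ → ∀ s, h j (x + (n * D) • s) = 0 := by
    intro j hj hne
    have hconst : ∀ s, h j (x + (n * D) • s) = h j x := by
      by_contra hnc
      obtain ⟨i, hi, hinv, -, hsp⟩ := hspread j hj hnc
      obtain ⟨s₁, hs₁⟩ := hsp₀ (1 / 2) (by norm_num)
      obtain ⟨s₂, hs₂⟩ := hsp (1 / 2) (by norm_num)
      obtain ⟨a, b, ha, hb, hab⟩ := hsep j₀ hj₀ j hj hne.symm i₀ hi₀ i hi (s₁ - s₂)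
      have e1 := hinv₀ (D • s₁) (-a) (by rw [map_neg, ha, neg_zero])
      have e2 := hinv (D • s₂) b hb
      -- The common point: each side is reached by moving within the kernel that preserves the
      -- corresponding large value.
      have e3 : x + n • D • s₁ + n • -a = x + n • D • s₂ + n • b := by
        have : D • s₁ = D • s₂ + a + b := by
          rw [add_assoc, ← hab, smul_sub]; abel
        rw [this]
        module
      rw [mul_smul] at hs₁ hs₂
      have := hpair j hj hne (x + n • D • s₂ + n • b)
      rw [e2, ← e3, e1] at this
      linarith
    intro s
    rw [hconst]
    refine le_antisymm (le_of_forall_pos_le_add fun ε hε => ?_) (h0 j hj x)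
    obtain ⟨s', hs'⟩ := hsp₀ ε hε
    have := hpair j hj hne (x + (n * D) • s')
    rw [hconst] at this
    linarith
  have heq : ∀ s, 1 - ∑ j ∈ J, h j (x + (n * D) • s) = 1 - h j₀ (x + (n * D) • s) := by
    intro s
    rw [Finset.sum_eq_single j₀ (fun j hj hne => hzero j hj hne s) fun h => absurd hj₀ h]
  refine Or.inr ⟨i₀, ⟨j₀, hj₀, hi₀⟩, fun s r hr => ?_, fun m hm s => ?_⟩
  · beta_reduce
    rw [heq, add_assoc, ← smul_add, heq, smul_add, ← add_assoc, mul_smul, mul_smul,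
      hinv₀ (D • s) (D • r) (by rw [map_nsmul, hr, smul_zero])]
  · refine ConstOrSpread.of_eq_one_sub (h := h j₀) ?_ fun s' => ?_
    · have := hcs₀ (D * m) (by positivity) (D • s)
      rwa [smul_smul, ← mul_assoc] at this
    · have := heq (s + m • s')
      rwa [smul_add, smul_smul, ← add_assoc] at this

end Good

/-! ### Choices of nonzero tile elements -/

section Choices

variable {G : Type*} [AddCommGroup G]

open Classical in
/-- The sequences `v` with `v i ∈ F i \ {0}` for `i < k` and `v i = 0` for `i ≥ k`. -/
noncomputable def choices (F : ℕ → Finset G) : ℕ → Finset (ℕ → G)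
  | 0 => {0}
  | k + 1 => (choices F k ×ˢ (F k).erase 0).image fun p => Function.update p.1 k p.2

variable {F : ℕ → Finset G}

lemma mem_choices {k : ℕ} {v : ℕ → G} :
    v ∈ choices F k ↔ (∀ i < k, v i ∈ F i ∧ v i ≠ 0) ∧ ∀ i, k ≤ i → v i = 0 := by
  classical
  induction k generalizing v with
  | zero =>
    simp only [choices, Finset.mem_singleton]
    exact ⟨by rintro rfl; simp, fun h => funext fun i => h.2 i (Nat.zero_le i)⟩
  | succ k ih =>
    simp only [choices, Finset.mem_image, Finset.mem_product, Finset.mem_erase, Prod.exists]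
    constructor
    · rintro ⟨w, g, ⟨hw, hg0, hg⟩, rfl⟩
      rw [ih] at hw
      refine ⟨fun i hi => ?_, fun i hi => ?_⟩
      · rcases Nat.lt_succ_iff_lt_or_eq.mp hi with hi | rfl
        · rw [Function.update_of_ne hi.ne]; exact hw.1 i hi
        · rw [Function.update_self]; exact ⟨hg, hg0⟩
      · rw [Function.update_of_ne (by omega)]; exact hw.2 i (by omega)
    · intro hv
      refine ⟨Function.update v k 0, v k, ⟨ih.mpr ⟨fun i hi => ?_, fun i hi => ?_⟩,
        (hv.1 k (Nat.lt_succ_self k)).2, (hv.1 k (Nat.lt_succ_self k)).1⟩, ?_⟩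
      · rw [Function.update_of_ne hi.ne]; exact hv.1 i (by omega)
      · rcases eq_or_lt_of_le hi with rfl | hi
        · simp
        · rw [Function.update_of_ne hi.ne']; exact hv.2 i hi
      · simp

lemma update_mem_choices {k : ℕ} {v : ℕ → G} {g : G} (hv : v ∈ choices F k) (hg : g ∈ F k)
    (hg0 : g ≠ 0) : Function.update v k g ∈ choices F (k + 1) := by
  classical
  simp only [choices, Finset.mem_image, Finset.mem_product, Finset.mem_erase, Prod.exists]
  exact ⟨v, g, ⟨hv, hg0, hg⟩, rfl⟩

lemma update_zero_mem_choices {k : ℕ} {v : ℕ → G} (hv : v ∈ choices F (k + 1)) :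
    Function.update v k 0 ∈ choices F k := by
  rw [mem_choices] at hv ⊢
  refine ⟨fun i hi => ?_, fun i hi => ?_⟩
  · rw [Function.update_of_ne hi.ne]; exact hv.1 i (by omega)
  · rcases eq_or_lt_of_le hi with rfl | hi
    · simp
    · rw [Function.update_of_ne hi.ne']; exact hv.2 i hi

lemma sum_choices_succ [DecidableEq G] {M : Type*} [AddCommMonoid M] (k : ℕ) (f : (ℕ → G) → M) :
    ∑ v ∈ choices F (k + 1), f v =
      ∑ v ∈ choices F k, ∑ g ∈ (F k).erase 0, f (Function.update v k g) := by
  classical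
  rw [choices, Finset.sum_image, Finset.sum_product]
  · refine Finset.sum_congr rfl fun v _ => Finset.sum_congr ?_ fun _ _ => rfl
    ext; simp
  · rintro ⟨v, g⟩ hv ⟨w, g'⟩ hw h
    simp only [Finset.coe_product, Set.mem_prod, Finset.mem_coe, mem_choices] at hv hw
    simp only at h
    have hg : g = g' := by simpa using congrFun h k
    have hvw : v = w := by
      ext i
      rcases eq_or_ne i k with rfl | hi
      · rw [hv.1.2 i le_rfl, hw.1.2 i le_rfl]
      · simpa [Function.update_of_ne hi] using congrFun h i
    rw [hg, hvw]

lemma iterAvg_update {Q : ℕ} {φ : G → ℝ} (v : ℕ → G) (k : ℕ) (g : G) :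
    iterAvg Q φ (Function.update v k g) (k + 1) = avg Q g (iterAvg Q φ v k) := by
  rw [iterAvg, Function.update_self,
    iterAvg_congr (w := v) fun i hi => Function.update_of_ne hi.ne _ _]

/-- Expanding every term by one more tile turns the sum into the number of terms minus the sum, so
integrality propagates from `φ`. -/
lemma exists_int_sum_iterAvg {K Q : ℕ} {φ : G → ℝ} (hφ : IsTiled F K Q φ)
    (h0 : ∀ i < K, 0 ∈ F i) (hint : ∀ x, ∃ z : ℤ, φ x = z) (x : G) : ∀ k ≤ K,
    ∃ z : ℤ, ∑ v ∈ choices F k, iterAvg Q φ v k x = z := by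
  classical
  intro k
  induction k with
  | zero =>
    intro _
    simpa [choices, iterAvg] using hint x
  | succ k ih =>
    intro hk
    obtain ⟨z, hz⟩ := ih (by omega)
    refine ⟨(choices F k).card - z, ?_⟩
    rw [sum_choices_succ]
    have : ∀ v ∈ choices F k, ∑ g ∈ (F k).erase 0,
        iterAvg Q φ (Function.update v k g) (k + 1) x = 1 - iterAvg Q φ v k x := by
      intro v _
      simp_rw [iterAvg_update]
      rw [(hφ.iterAvg v k).eq_one_sub_sum_avg (by omega : k < K) (h0 k (by omega)) x]
      ring
    rw [Finset.sum_congr rfl this, Finset.sum_sub_distrib, hz]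
    simp

end Choices

/-! ### The structure theorem -/

section Structure

variable {G κ : Type*} [AddCommGroup G]

/-- The averages along the choices whose key is `W`, added up. -/
noncomputable def keyAvg [DecidableEq κ] (F : ℕ → Finset G) (K Q : ℕ) (φ : G → ℝ)
    (key : (ℕ → G) → κ) (W : κ) (x : G) : ℝ :=
  ∑ v ∈ choices F K with key v = W, iterAvg Q φ v K x

variable [DecidableEq κ] {F : ℕ → Finset G} {K Q : ℕ} {φ : G → ℝ} {key : (ℕ → G) → κ}

/-- By `hstar`, every choice sharing its key with an extension of `v` is itself an extension of `v`,
so the whole key average occurs inside this one expansion. -/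
lemma iterAvg_eq_one_sub_sum_keyAvg [DecidableEq G] (hφ : IsTiled F (K + 1) Q φ)
    (h0 : ∀ i < K + 1, 0 ∈ F i)
    (hstar : ∀ v ∈ choices F (K + 1), ∀ w ∈ choices F (K + 1), key v = key w → ∀ i < K, v i = w i)
    {v : ℕ → G} (hv : v ∈ choices F K) (x : G) :
    iterAvg Q φ v K x = 1 - ∑ W ∈ ((F K).erase 0).image fun g => key (Function.update v K g),
      keyAvg F (K + 1) Q φ key W x := by
  rw [(hφ.iterAvg v K).eq_one_sub_sum_avg (Nat.lt_succ_self K) (h0 K (Nat.lt_succ_self K)) x]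
  congr 1
  rw [← Finset.sum_fiberwise_of_maps_to (t := ((F K).erase 0).image fun g =>
    key (Function.update v K g)) (g := fun g => key (Function.update v K g))
    fun g hg => Finset.mem_image_of_mem _ hg]
  refine Finset.sum_congr rfl fun W hW => ?_
  obtain ⟨g₀, hg₀, rfl⟩ := Finset.mem_image.mp hW
  rw [Finset.mem_erase] at hg₀
  refine Finset.sum_nbij' (fun g => Function.update v K g) (fun w => w K) ?_ ?_ ?_ ?_ ?_
  · intro g hg
    simp only [Finset.mem_filter, Finset.mem_erase] at hg ⊢
    exact ⟨update_mem_choices hv hg.1.2 hg.1.1, hg.2⟩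
  · intro w hw
    simp only [Finset.mem_filter, Finset.mem_erase] at hw ⊢
    have hw' := (mem_choices.mp hw.1).1 K (Nat.lt_succ_self K)
    refine ⟨⟨hw'.2, hw'.1⟩, ?_⟩
    rw [← hw.2]
    congr 1
    ext i
    rcases lt_trichotomy i K with hi | rfl | hi
    · have := hstar w hw.1 _ (update_mem_choices hv hg₀.2 hg₀.1) hw.2 i hi
      rw [Function.update_of_ne hi.ne] at this ⊢
      exact this.symm
    · simp
    · rw [Function.update_of_ne hi.ne', (mem_choices.mp hw.1).2 i hi,
        (mem_choices.mp hv).2 i hi.le]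
  · intro g _; simp
  · intro w hw
    simp only [Finset.mem_filter] at hw
    ext i
    rcases lt_trichotomy i K with hi | rfl | hi
    · have := hstar w hw.1 _ (update_mem_choices hv hg₀.2 hg₀.1) hw.2 i hi
      rw [Function.update_of_ne hi.ne] at this ⊢
      exact this.symm
    · simp
    · rw [Function.update_of_ne hi.ne', (mem_choices.mp hw.1).2 i hi,
        (mem_choices.mp hv).2 i hi.le]
  · intro g _; rw [iterAvg_update]

lemma keyAvg_nonneg (hφ : IsTiled F K Q φ) (W : κ) (x : G) : 0 ≤ keyAvg F K Q φ key W x :=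
  Finset.sum_nonneg fun v _ => ((hφ.iterAvg v K).1 x).1

/-- A key average is one of several nonnegative terms whose sum is `1` minus a nonnegative average.
-/
lemma keyAvg_le_one [DecidableEq G] (hφ : IsTiled F (K + 1) Q φ) (h0 : ∀ i < K + 1, 0 ∈ F i)
    (hstar : ∀ v ∈ choices F (K + 1), ∀ w ∈ choices F (K + 1), key v = key w → ∀ i < K, v i = w i)
    {v : ℕ → G} (hv : v ∈ choices F (K + 1)) (x : G) :
    keyAvg F (K + 1) Q φ key (key v) x ≤ 1 := by
  have h1 := iterAvg_eq_one_sub_sum_keyAvg hφ h0 hstar (update_zero_mem_choices hv) x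
  have h2 := ((hφ.iterAvg (Function.update v K 0) K).1 x).1
  have hvK := (mem_choices.mp hv).1 K (Nat.lt_succ_self K)
  have h3 : key v ∈ ((F K).erase 0).image
      fun g => key (Function.update (Function.update v K 0) K g) :=
    Finset.mem_image.mpr ⟨v K, Finset.mem_erase.mpr ⟨hvK.2, hvK.1⟩, by simp⟩
  have h4 := Finset.single_le_sum (f := fun W => keyAvg F (K + 1) Q φ key W x)
    (fun W _ => keyAvg_nonneg hφ W x) h3
  linarith

/-- The structure theorem: the weight of a tiling is, on each coset of some `n G`, either constant
or periodic along one of finitely many hyperplanes. -/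
theorem exists_good (hG : HasFiniteQuotients G) (hφ : IsTiled F (K + 1) Q φ) (hQ : 0 < Q)
    (hint : ∀ x, ∃ z : ℤ, φ x = z) (h0 : ∀ i < K + 1, 0 ∈ F i)
    (hstar : ∀ v ∈ choices F (K + 1), ∀ w ∈ choices F (K + 1), key v = key w → ∀ i < K, v i = w i)
    {l : κ → G →+ ℤ} {N D : ℕ} (hN : 0 < N) (hD : 0 < D)
    (hker : ∀ v ∈ choices F (K + 1), ∀ s, l (key v) s = 0 →
      ∃ c : ℕ → ℤ, N • s = ∑ i ∈ Finset.range (K + 1), c i • v i)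
    (hpos : ∀ v ∈ choices F (K + 1), ∃ e, 0 < l (key v) e)
    (hsep : ∀ v ∈ choices F (K + 1), ∀ w ∈ choices F (K + 1), key v ≠ key w → ∀ t, ∃ a b,
      l (key v) a = 0 ∧ l (key w) b = 0 ∧ D • t = a + b) :
    ∃ n : ℕ, 0 < n ∧ Good l n {W | ∃ v ∈ choices F (K + 1), key v = W} φ := by
  classical
  set I := (choices F (K + 1)).image key with hI
  have hmemI : ∀ W, W ∈ I ↔ ∃ v ∈ choices F (K + 1), key v = W := fun W => Finset.mem_image
  set Ψ := keyAvg F (K + 1) Q φ key with hΨ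
  have hΨ01 : ∀ W ∈ I, ∀ x, 0 ≤ Ψ W x ∧ Ψ W x ≤ 1 := by
    intro W hW x
    obtain ⟨v, hv, rfl⟩ := (hmemI W).mp hW
    exact ⟨keyAvg_nonneg hφ _ x, keyAvg_le_one hφ h0 hstar hv x⟩
  have hinv : ∀ W, ∀ s, l W s = 0 → ∀ x, Ψ W (x + (Q * N) • s) = Ψ W x := by
    intro W s hs x
    refine Finset.sum_congr rfl fun v hv => ?_
    rw [Finset.mem_filter] at hv
    obtain ⟨hv, rfl⟩ := hv
    obtain ⟨c, hc⟩ := hker v hv s hs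
    rw [mul_smul, hc]
    exact add_eq_of_invariant _ _ (fun i hi => iterAvg_add_smul hφ.1 v (K + 1) i
      (Finset.mem_range.mp hi)) c x
  have hsum : ∀ x, ∑ W ∈ I, (Ψ W x : UnitAddCircle) = 0 := by
    intro x
    obtain ⟨z, hz⟩ := exists_int_sum_iterAvg hφ h0 hint x (K + 1) le_rfl
    rw [← Finset.sum_fiberwise_of_maps_to (t := I) (g := key)
      fun v hv => Finset.mem_image_of_mem _ hv] at hz
    have h1 : ((∑ W ∈ I, Ψ W x : ℝ) : UnitAddCircle) = 0 := by
      rw [hΨ]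
      unfold keyAvg
      rw [hz, AddCircle.coe_eq_zero_iff]
      exact ⟨z, by simp⟩
    rw [← h1]
    exact (map_sum (QuotientAddGroup.mk' (AddSubgroup.zmultiples (1 : ℝ))) _ _).symm
  set M := Q * N * D with hM
  have hM0 : 0 < M := by positivity
  have hpoly : ∀ W ∈ I, ∀ t, (fwdDiff (M • t))^[(I.erase W).card + 1]
      (fun x => (Ψ W x : UnitAddCircle)) = fun _ => 0 := by
    intro W hW t
    have hsplit : ∀ j, ∃ b, j ∈ I.erase W → l j b = 0 ∧ l W (D • t - b) = 0 := by
      intro j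
      by_cases hj : j ∈ I.erase W
      · obtain ⟨v, hv, rfl⟩ := (hmemI W).mp hW
        obtain ⟨hne, hj⟩ := Finset.mem_erase.mp hj
        obtain ⟨w, hw, rfl⟩ := (hmemI j).mp hj
        obtain ⟨a, b, ha, hb, hab⟩ := hsep v hv w hw hne.symm t
        exact ⟨b, fun _ => ⟨hb, by rw [hab, add_sub_cancel_right, ha]⟩⟩
      · exact ⟨0, fun h => absurd h hj⟩
    choose b hb using hsplit
    refine iterate_fwdDiff_eq_zero_of_sum_const (I.erase W) (M • t) (fun j => (Q * N) • b j) _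
      (fun j x => (Ψ j x : UnitAddCircle)) (fun j hj x => ?_) (fun j hj x => ?_) fun x y => ?_
    · rw [hM, mul_smul, ← smul_sub, hinv W _ (hb j hj).2]
    · simp only [hinv j _ (hb j hj).1]
    · rw [Finset.add_sum_erase I (fun j => (Ψ j x : UnitAddCircle)) hW,
        Finset.add_sum_erase I (fun j => (Ψ j y : UnitAddCircle)) hW, hsum, hsum]
  have hmod : ∀ W, ∃ n : ℕ, 0 < n ∧ (W ∈ I →
      ∀ n' : ℕ, 0 < n' → n ∣ n' → ∀ x, ConstOrSpread n' (Ψ W) x) := by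
    intro W
    by_cases hW : W ∈ I
    · obtain ⟨v, hv, rfl⟩ := (hmemI W).mp hW
      obtain ⟨e, he⟩ := hpos v hv
      obtain ⟨n, hn, h⟩ := exists_modulus_constOrSpread hG he (hΨ01 _ hW) hM0 (fun s hs x => by
        rw [hM, mul_smul, hinv _ (D • s) (by rw [map_nsmul, hs, smul_zero])]) (hpoly _ hW)
      exact ⟨n, hn, fun _ => h⟩
    · exact ⟨1, one_pos, fun h => absurd h hW⟩
  choose m hm0 hm using hmod
  set n := M * ∏ W ∈ I, m W with hn
  have hn0 : 0 < n := Nat.mul_pos hM0 (Finset.prod_pos fun W _ => hm0 W)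
  have hleaf : ∀ W ∈ I, Good l n {W} (Ψ W) := by
    intro W hW x
    refine Or.inr ⟨W, rfl, fun s r hr => ?_, fun q hq s => ?_⟩
    · rw [hn, hM, mul_assoc (Q * N), mul_smul (Q * N) _ r, hinv W _ (by
        rw [map_nsmul, hr, smul_zero])]
    · refine hm W hW _ (by positivity) ?_ _
      exact ((Finset.dvd_prod_of_mem m hW).mul_left M).mul_right q
  -- Induction from the deepest level up, with `j = K - k`; each level costs a factor `D`. The
  -- hyperplanes allowed for `v` are those of its extensions.
  have hrec : ∀ j k, k + j = K → ∀ v ∈ choices F k, Good l (n * D ^ (j + 1))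
      {W | ∃ w ∈ choices F (K + 1), key w = W ∧ ∀ i < k, w i = v i} (iterAvg Q φ v k) := by
    intro j
    induction j with
    | zero =>
      intro k hk v hv
      obtain rfl : k = K := by omega
      have hJ : ∀ W ∈ ((F k).erase 0).image fun g => key (Function.update v k g),
          ∃ w ∈ choices F (k + 1), key w = W ∧ ∀ i < k, w i = v i := by
        intro W hW
        obtain ⟨g, hg, rfl⟩ := Finset.mem_image.mp hW
        rw [Finset.mem_erase] at hg
        exact ⟨_, update_mem_choices hv hg.2 hg.1, rfl, fun i hi => Function.update_of_ne hi.ne _ _⟩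
      have hJI : ∀ W ∈ ((F k).erase 0).image fun g => key (Function.update v k g), W ∈ I := by
        intro W hW
        obtain ⟨w, hw, hwW, -⟩ := hJ W hW
        exact (hmemI W).mpr ⟨w, hw, hwW⟩
      -- At the last level different `g` may give the same hyperplane, so terms are grouped by key
      -- before separation is used.
      have hexp := iterAvg_eq_one_sub_sum_keyAvg hφ h0 hstar hv
      rw [show iterAvg Q φ v k = _ from funext hexp, zero_add, pow_one]
      refine (Good.one_sub_sum (S := fun W => {W}) hD ?_ (fun W _ x => keyAvg_nonneg hφ W x) ?_
        fun W hW => hleaf W (hJI W hW)).mono ?_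
      · rintro W hW W' hW' hne _ rfl _ rfl
        obtain ⟨w, hw, rfl, -⟩ := hJ _ hW
        obtain ⟨w', hw', rfl, -⟩ := hJ _ hW'
        exact hsep w hw w' hw' hne
      · intro x
        have := ((hφ.iterAvg v k).1 x).1
        rw [hexp] at this
        linarith
      · rintro _ ⟨W, hW, rfl⟩
        exact hJ _ hW
    | succ j ih =>
      intro k hk v hv
      have hexp : ∀ x, iterAvg Q φ v k x = 1 - ∑ g ∈ (F k).erase 0,
          iterAvg Q φ (Function.update v k g) (k + 1) x := by
        intro x
        simp_rw [iterAvg_update]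
        exact (hφ.iterAvg v k).eq_one_sub_sum_avg (by omega) (h0 k (by omega)) x
      rw [show iterAvg Q φ v k = _ from funext hexp, pow_succ, ← mul_assoc]
      refine (Good.one_sub_sum hD (S := fun g => {W | ∃ w ∈ choices F (K + 1), key w = W ∧
        ∀ i < k + 1, w i = Function.update v k g i}) ?_
        (fun g _ x => ((hφ.iterAvg _ _).1 x).1) ?_ fun g hg => ?_).mono ?_
      · rintro g hg g' hg' hne _ ⟨w, hw, rfl, hwg⟩ _ ⟨w', hw', rfl, hwg'⟩
        -- Here `k < K`, so a shared hyperplane would force equal entries at `k`: different branches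
        -- never share a key.
        refine hsep w hw w' hw' fun hkey => hne ?_
        have h1 := hwg k (Nat.lt_succ_self k)
        have h2 := hwg' k (Nat.lt_succ_self k)
        rw [Function.update_self] at h1 h2
        rw [← h1, ← h2]
        exact hstar w hw w' hw' hkey k (by omega)
      · intro x
        have := ((hφ.iterAvg v k).1 x).1
        rw [hexp] at this
        linarith
      · rw [Finset.mem_erase] at hg
        exact ih (k + 1) (by omega) _ (update_mem_choices hv hg.2 hg.1)
      · rintro _ ⟨g, hg, w, hw, rfl, hwg⟩
        refine ⟨w, hw, rfl, fun i hi => ?_⟩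
        rw [hwg i (by omega), Function.update_of_ne hi.ne]
  refine ⟨n * D ^ (K + 1), by positivity, (hrec K 0 (by omega) 0 (by simp [choices])).mono ?_⟩
  rintro _ ⟨w, hw, rfl, -⟩
  exact ⟨w, hw, rfl⟩

end Structure

/-! ### Periodizing a piece transversally to its hyperplane -/

section Periodization

variable {G κ : Type*} [AddCommGroup G]

open Classical in
/-- The number of representations `x = f + a` with `f ∈ F` and `a ∈ A`. -/
noncomputable def reprCount (F : Finset G) (A : Set G) (x : G) : ℕ :=
  (F.filter fun f => x - f ∈ A).card

lemma isCoTile_iff {F : Finset G} {A : Set G} : IsCoTile F A ↔ ∀ x, reprCount F A x = 1 := by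
  classical
  refine forall_congr' fun x => ?_
  rw [reprCount, Finset.card_eq_one]
  constructor
  · rintro ⟨⟨f, a⟩, ⟨hf, ha, hx⟩, huniq⟩
    simp only at hf ha hx
    refine ⟨f, Finset.eq_singleton_iff_unique_mem.mpr ⟨?_, fun g hg => ?_⟩⟩
    · rw [Finset.mem_filter, ← hx, add_sub_cancel_left]; exact ⟨hf, ha⟩
    · rw [Finset.mem_filter] at hg
      exact congrArg Prod.fst (huniq (g, x - g) ⟨hg.1, hg.2, add_sub_cancel _ _⟩)
  · rintro ⟨f, hf⟩
    have hmem : f ∈ F ∧ x - f ∈ A := by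
      rw [← Finset.mem_filter (p := fun f => x - f ∈ A), hf, Finset.mem_singleton]
    refine ⟨(f, x - f), ⟨hmem.1, hmem.2, add_sub_cancel _ _⟩, ?_⟩
    rintro ⟨g, a⟩ ⟨hg, ha, hx⟩
    simp only at hg ha hx
    have hag : a = x - g := by rw [← hx, add_sub_cancel_left]
    have hgf : g ∈ F.filter fun f => x - f ∈ A := Finset.mem_filter.mpr ⟨hg, hag ▸ ha⟩
    rw [hf, Finset.mem_singleton] at hgf
    rw [hag, hgf]

lemma reprCount_le_card (F : Finset G) (A : Set G) (x : G) : reprCount F A x ≤ F.card := by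
  classical exact Finset.card_filter_le _ _

lemma reprCount_congr {F : Finset G} {A B : Set G} {x y : G}
    (h : ∀ f ∈ F, x - f ∈ A ↔ y - f ∈ B) : reprCount F A x = reprCount F B y := by
  classical
  rw [reprCount, reprCount]
  congr 1
  exact Finset.filter_congr h

lemma reprCount_eq_sum {F : Finset G} {A : Set G} {x : G} [DecidablePred (· ∈ A)] :
    reprCount F A x = ∑ f ∈ F, if x - f ∈ A then 1 else 0 := by
  classical
  rw [reprCount, Finset.card_filter]
  exact Finset.sum_congr rfl fun f _ => by congr

/-- A set that is periodic along a hyperplane and whose representation counts are periodic can be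
replaced by a fully periodic set with the same representation counts. -/
lemma exists_periodic_of_reprCount_periodic (hG : HasFiniteQuotients G) {l : G →+ ℤ} {e : G}
    (he : 0 < l e) {B : Set G} {n : ℕ} (hn : 0 < n)
    (hB : ∀ s, l s = 0 → ∀ x, x + n • s ∈ B ↔ x ∈ B) {k : ℕ} (F : Fin k → Finset G)
    (hF : ∀ i x s, reprCount (F i) B (x + n • s) = reprCount (F i) B x) :
    ∃ (B' : Set G) (p : ℕ), 0 < p ∧ (∀ x s, x + p • s ∈ B' ↔ x ∈ B') ∧
      ∀ i x, reprCount (F i) B' x = reprCount (F i) B x := by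
  classical
  obtain ⟨C, hC⟩ : ∃ C : ℕ, ∀ i, ∀ f ∈ F i, |l f| ≤ C := by
    refine ⟨∑ i, ∑ f ∈ F i, (l f).natAbs, fun i f hf => ?_⟩
    rw [Int.abs_eq_natAbs]
    exact_mod_cast (Finset.single_le_sum (f := fun f => (l f).natAbs) (fun _ _ => Nat.zero_le _)
      hf).trans (Finset.single_le_sum (f := fun i => ∑ f ∈ F i, (l f).natAbs)
        (fun _ _ => Nat.zero_le _) (Finset.mem_univ i))
  -- A multiple of `n`, so that counts are unchanged under it, and of height above every tile
  -- element.
  set e₁ := n • (C + 1) • e with he₁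
  have hE : (C : ℤ) < l e₁ := by
    rw [he₁, map_nsmul, map_nsmul, smul_smul, nsmul_eq_mul]
    have h1 : (1 : ℤ) ≤ l e := he
    have h2 : ((C : ℤ) + 1) ≤ ((n * (C + 1) : ℕ) : ℤ) := by
      exact_mod_cast Nat.le_mul_of_pos_left _ hn
    nlinarith
  obtain ⟨R, hR⟩ := hG n hn
  -- The trace of `B` on the slab `|l| ≤ C` moved by `k • e₁`. Invariance under `n • ker l` leaves
  -- only height and class modulo `n`, hence finitely many states and a repetition.
  let state : ℕ → Set (Finset.Icc (-C : ℤ) C × R) := fun k =>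
    {q | ∃ x, l x = q.1 ∧ (∃ s, x = q.2 + n • s) ∧ x + k • e₁ ∈ B}
  have hstate : ∀ k (a : Finset.Icc (-C : ℤ) C) (r : R) x, l x = (a : ℤ) → (∃ s, x = (r : G) + n • s) →
      ((a, r) ∈ state k ↔ x + k • e₁ ∈ B) := by
    rintro k a r x hxa ⟨s, hs⟩
    constructor
    · rintro ⟨y, hya, ⟨s', hs'⟩, hy⟩
      have hs0 : l (s - s') = 0 := by
        have h1 : l x - l y = n * l (s - s') := by
          rw [hs, hs']
          simp only [map_add, map_nsmul, map_sub, nsmul_eq_mul]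
          ring
        rw [hxa, hya, sub_self] at h1
        have hn' : (n : ℤ) ≠ 0 := by exact_mod_cast hn.ne'
        exact (mul_eq_zero.mp h1.symm).resolve_left hn'
      have := (hB _ hs0 (y + k • e₁)).mpr hy
      convert this using 1
      rw [hs, hs', smul_sub]
      simp only
      abel
    · intro hx
      exact ⟨x, hxa, ⟨s, hs⟩, hx⟩
  obtain ⟨k₁, k₂, hlt, heq⟩ : ∃ k₁ k₂, k₁ < k₂ ∧ state k₁ = state k₂ := by
    obtain ⟨a, b, hne, hab⟩ := Finite.exists_ne_map_eq_of_infinite state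
    rcases lt_or_gt_of_ne hne with h | h
    · exact ⟨a, b, h, hab⟩
    · exact ⟨b, a, h, hab.symm⟩
  obtain ⟨p, rfl⟩ := Nat.exists_eq_add_of_lt hlt
  set e₂ := (p + 1) • e₁ with he₂
  set P := l e₂ with hP
  have hCP : (C : ℤ) < P := by
    rw [hP, he₂, map_nsmul, nsmul_eq_mul]
    push_cast
    nlinarith
  have hP0 : 0 < P := by omega
  set B₀ : Set G := {x | x + k₁ • e₁ ∈ B}
  have hB₀ : ∀ x, x ∈ B₀ ↔ x + k₁ • e₁ ∈ B := fun _ => Iff.rfl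
  have hwin : ∀ x, |l x| ≤ C → (x + e₂ ∈ B₀ ↔ x ∈ B₀) := by
    intro x hx
    obtain ⟨r, hr, s, hs⟩ := hR x
    have ha : l x ∈ Finset.Icc (-C : ℤ) C := Finset.mem_Icc.mpr (abs_le.mp hx)
    have h1 := hstate k₁ ⟨l x, ha⟩ ⟨r, hr⟩ x rfl ⟨s, hs⟩
    have h2 := hstate (k₁ + p + 1) ⟨l x, ha⟩ ⟨r, hr⟩ x rfl ⟨s, hs⟩
    rw [heq, h2] at h1
    rw [hB₀, hB₀, ← h1, he₂]
    refine iff_of_eq (congrArg (· ∈ B) ?_)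
    module
  have hB₀inv : ∀ s, l s = 0 → ∀ x, x + n • s ∈ B₀ ↔ x ∈ B₀ := by
    intro s hs x
    rw [hB₀, hB₀, add_right_comm, hB s hs]
  -- Repeat the slab `0 ≤ l < P` of `B₀` with period `e₂`.
  set B' : Set G := {x | x - (l x / P) • e₂ ∈ B₀}
  have hB' : ∀ x, x ∈ B' ↔ x - (l x / P) • e₂ ∈ B₀ := fun _ => Iff.rfl
  have hB'e : ∀ x (q : ℤ), x + q • e₂ ∈ B' ↔ x ∈ B' := by
    intro x q
    have h1 : l (x + q • e₂) / P = l x / P + q := by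
      rw [map_add, map_zsmul, smul_eq_mul, ← hP, Int.add_mul_ediv_right _ _ hP0.ne']
    rw [hB', hB', h1]
    refine iff_of_eq (congrArg (· ∈ B₀) ?_)
    module
  have hB'inv : ∀ s, l s = 0 → ∀ x, x + n • s ∈ B' ↔ x ∈ B' := by
    intro s hs x
    have h1 : l (x + n • s) = l x := by rw [map_add, map_nsmul, hs, smul_zero, add_zero]
    rw [hB', hB', h1, ← hB₀inv s hs (x - _)]
    refine iff_of_eq (congrArg (· ∈ B₀) ?_)
    abel
  obtain ⟨P', hP'⟩ := Int.eq_ofNat_of_zero_le hP0.le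
  refine ⟨B', n * P', Nat.mul_pos hn (by omega), fun x s => ?_, fun i x => ?_⟩
  -- The translation is a multiple of `e₂` plus `n` times an element of `ker l`.
  · have h1 : x + (n * P') • s = x + (n * l s) • e₂ + n • (P' • s - l s • e₂) := by module
    rw [h1, hB'inv _ ?_, hB'e]
    rw [map_sub, map_nsmul, map_zsmul, ← hP, hP', smul_eq_mul, nsmul_eq_mul]
    ring
  -- Bring `x` into the slab. The points `y - f` leave it by at most `C`, where the repeated state
  -- makes `B'` agree with `B₀`; then return to `x` by periodicity of the counts.
  · set q := l x / P with hq
    set y := x + (-q) • e₂ with hy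
    have hly : 0 ≤ l y ∧ l y < P := by
      have h1 : l y = l x % P := by
        rw [hy, map_add, map_zsmul, smul_eq_mul, ← hP, hq, Int.emod_def]; ring
      rw [h1]
      exact ⟨Int.emod_nonneg _ hP0.ne', Int.emod_lt_of_pos _ hP0⟩
    have s1 : reprCount (F i) B' x = reprCount (F i) B' y := reprCount_congr fun f _ => by
      rw [hy, add_sub_right_comm, hB'e]
    have s2 : reprCount (F i) B' y = reprCount (F i) B₀ y := reprCount_congr fun f hf => by
      set z := y - f with hz
      have hf' := abs_le.mp (hC i f hf)
      have hlz : l z = l y - l f := map_sub _ _ _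
      rcases lt_or_ge (l z) 0 with hneg | hnn
      · have h1 : l z / P = -1 := by
          rw [Int.ediv_eq_iff_of_pos hP0]; constructor <;> linarith
        rw [hB', h1, neg_smul, one_smul, sub_neg_eq_add]
        exact hwin z (abs_le.mpr ⟨by linarith, by linarith⟩)
      rcases lt_or_ge (l z) P with hlt | hge
      · rw [hB', Int.ediv_eq_zero_of_lt hnn hlt, zero_smul, sub_zero]
      · have h1 : l z / P = 1 := by
          rw [Int.ediv_eq_iff_of_pos hP0]; constructor <;> linarith
        rw [hB', h1, one_smul, ← hwin (z - e₂), sub_add_cancel]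
        rw [map_sub, ← hP]
        exact abs_le.mpr ⟨by linarith, by linarith⟩
    have s3 : reprCount (F i) B₀ y = reprCount (F i) B (y + k₁ • e₁) :=
      reprCount_congr fun f _ => by
        rw [hB₀, add_sub_right_comm y]
    have h4 : y + k₁ • e₁ = x + n • ((k₁ : ℤ) • (C + 1) • e + (-q) • (p + 1) • (C + 1) • e) := by
      rw [hy, he₂, he₁]; module
    rw [s1, s2, s3, h4, hF]

end Periodization

/-! ### Assembling the periodic co-tile -/

section Assembly

variable {G κ : Type*} [AddCommGroup G]

/-- A tiling whose indicator function has the hyperplane structure of `Good` can be replaced by a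
fully periodic one. -/
theorem exists_periodic_of_good (hG : HasFiniteQuotients G) {k : ℕ} (hk : 0 < k)
    {F : Fin k → Finset G} (h0 : ∀ i, 0 ∈ F i) {A : Set G} (hA : IsJointCoTile F A)
    {l : κ → G →+ ℤ} {I : Finset κ} {n D : ℕ} (hn : 0 < n) (hD : 0 < D)
    (hpos : ∀ W ∈ I, ∃ e, 0 < l W e)
    (hsep : ∀ W ∈ I, ∀ W' ∈ I, W ≠ W' → ∀ t, ∃ a b,
      l W a = 0 ∧ l W' b = 0 ∧ D • t = a + b)
    (hgood : Good l n I (A.indicator fun _ => (1 : ℝ))) :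
    ∃ (A' : Set G) (p : ℕ), IsJointCoTile F A' ∧ 0 < p ∧ ∀ x s, x + p • s ∈ A' ↔ x ∈ A' := by
  classical
  have hind : ∀ x y, A.indicator (fun _ => (1 : ℝ)) x = A.indicator (fun _ => (1 : ℝ)) y →
      (x ∈ A ↔ y ∈ A) := by
    intro x y h
    by_cases hx : x ∈ A <;> by_cases hy : y ∈ A <;> simp_all
  obtain ⟨rep, hrep, hrep'⟩ : ∃ rep : G → G, (∀ x s, rep (x + n • s) = rep x) ∧
      ∀ x, ∃ s, x = rep x + n • s := by
    let H : AddSubgroup G := (nsmulAddMonoidHom n).range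
    refine ⟨fun x => ((x : G ⧸ H)).out, fun x s => ?_, fun x => ?_⟩
    · have : ((x + n • s : G) : G ⧸ H) = (x : G ⧸ H) := by
        rw [QuotientAddGroup.eq]
        exact ⟨-s, by simp⟩
      simp only [this]
    · have h1 : (((x : G ⧸ H).out : G) : G ⧸ H) = (x : G ⧸ H) := Quotient.out_eq' _
      rw [QuotientAddGroup.eq] at h1
      obtain ⟨s, hs⟩ := h1
      refine ⟨s, ?_⟩
      rw [nsmulAddMonoidHom_apply] at hs
      rw [hs]; abel
  by_cases hI : I = ∅
  · refine ⟨A, n, hA, hn, fun x s => ?_⟩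
    rcases hgood x with h | ⟨i, hi, -⟩
    · exact hind _ _ (h s)
    · simp [hI] at hi
  obtain ⟨W₀, hW₀⟩ := Finset.nonempty_iff_ne_empty.mpr hI
  -- Constant cosets are invariant along every hyperplane and are assigned to `W₀`.
  have hcls : ∀ x, ∃ W ∈ I, ∀ s r, l W r = 0 → (x + n • s + n • r ∈ A ↔ x + n • s ∈ A) := by
    intro x
    rcases hgood x with h | ⟨i, hi, h, -⟩
    · refine ⟨W₀, hW₀, fun s r _ => hind _ _ ?_⟩
      rw [h, add_assoc, ← smul_add, h]
    · exact ⟨i, hi, fun s r hr => hind _ _ (h s r hr)⟩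
  choose cls₀ hclsI hcls using hcls
  set cls : G → κ := fun x => cls₀ (rep x) with hclsdef
  have hclsn : ∀ x s, cls (x + n • s) = cls x := fun x s => by rw [hclsdef]; simp only [hrep]
  let B : κ → Set G := fun W => {x | x ∈ A ∧ cls x = W}
  have hBinv : ∀ W s, l W s = 0 → ∀ x, x + n • s ∈ B W ↔ x ∈ B W := by
    intro W s hs x
    change (_ ∧ cls _ = W) ↔ (_ ∧ cls _ = W)
    rw [hclsn]
    refine and_congr_left fun hW => ?_
    obtain ⟨s₀, hs₀⟩ := hrep' x
    have := hcls (rep x) s₀ s (by rw [← hs, ← hW])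
    rwa [← hs₀] at this
  have hsum : ∀ i x, ∑ W ∈ I, reprCount (F i) (B W) x = 1 := by
    intro i x
    rw [← isCoTile_iff.mp (hA i) x, reprCount, Finset.card_eq_sum_card_fiberwise
      (f := fun f => cls (x - f)) (t := I) fun f _ => hclsI _]
    refine Finset.sum_congr rfl fun W _ => ?_
    rw [reprCount, Finset.filter_filter]
    congr 1
    ext f
    simp [B]
  -- The counts sum to `1` and each is invariant along its own hyperplane, so each is polynomial
  -- along the line; being bounded, it is constant there.
  have hper : ∀ W ∈ I, ∀ i x s,
      reprCount (F i) (B W) (x + (n * D) • s) = reprCount (F i) (B W) x := by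
    intro W hW i x t
    have hinv : ∀ W s, l W s = 0 → ∀ x,
        reprCount (F i) (B W) (x + n • s) = reprCount (F i) (B W) x := fun W s hs x =>
      reprCount_congr fun f _ => by rw [add_sub_right_comm, hBinv W s hs]
    have hsplit : ∀ j, ∃ b, j ∈ I.erase W → l j b = 0 ∧ l W (D • t - b) = 0 := by
      intro j
      by_cases hj : j ∈ I.erase W
      · obtain ⟨hne, hj⟩ := Finset.mem_erase.mp hj
        obtain ⟨a, b, ha, hb, hab⟩ := hsep W hW j hj hne.symm t
        exact ⟨b, fun _ => ⟨hb, by rw [hab, add_sub_cancel_right, ha]⟩⟩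
      · exact ⟨0, fun h => absurd h hj⟩
    choose b hb using hsplit
    have hpoly := iterate_fwdDiff_eq_zero_of_sum_const (I.erase W) ((n * D) • t)
      (fun j => n • b j) (fun x => (reprCount (F i) (B W) x : ℝ))
      (fun j x => (reprCount (F i) (B j) x : ℝ))
      (fun j hj x => by rw [mul_smul, ← smul_sub, hinv W _ (hb j hj).2])
      (fun j hj x => by rw [hinv j _ (hb j hj).1]) fun x y => by
        rw [Finset.add_sum_erase I (fun j => (reprCount (F i) (B j) x : ℝ)) hW,
          Finset.add_sum_erase I (fun j => (reprCount (F i) (B j) y : ℝ)) hW]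
        exact_mod_cast (hsum i x).trans (hsum i y).symm
    have hline := iterate_fwdDiff_comp_line (fun x => (reprCount (F i) (B W) x : ℝ)) x
      ((n * D) • t) ((I.erase W).card + 1)
    rw [hpoly] at hline
    have := eq_of_iterate_fwdDiff_eq_zero_of_bounded (C := (F i).card) (fun m => by
      rw [Nat.abs_cast]
      exact_mod_cast reprCount_le_card _ _ _) _ hline 0
    simp only [zero_add, one_smul, zero_smul, add_zero] at this
    exact_mod_cast this
  have hrepl : ∀ W, ∃ (B' : Set G) (p : ℕ), 0 < p ∧ (W ∈ I → (∀ x s, x + p • s ∈ B' ↔ x ∈ B') ∧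
      ∀ i x, reprCount (F i) B' x = reprCount (F i) (B W) x) := by
    intro W
    by_cases hW : W ∈ I
    · obtain ⟨e, he⟩ := hpos W hW
      obtain ⟨B', p, hp, h1, h2⟩ := exists_periodic_of_reprCount_periodic hG he
        (B := B W) (Nat.mul_pos hn hD) (fun s hs x => by
          rw [mul_smul, hBinv W _ (by rw [map_nsmul, hs, smul_zero])]) F (hper W hW)
      exact ⟨B', p, hp, fun _ => ⟨h1, h2⟩⟩
    · exact ⟨∅, 1, one_pos, fun h => absurd h hW⟩
  choose B' p hp hB' using hrepl
  have hsum' : ∀ i x, ∑ W ∈ I, reprCount (F i) (B' W) x = 1 := by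
    intro i x
    rw [← hsum i x]
    exact Finset.sum_congr rfl fun W hW => (hB' W hW).2 i x
  let g : G → ℕ := fun x => (I.filter fun W => x ∈ B' W).card
  have hg : ∀ i x, ∑ f ∈ F i, g (x - f) = 1 := by
    intro i x
    rw [← hsum' i x]
    simp_rw [reprCount_eq_sum]
    rw [Finset.sum_comm]
    refine Finset.sum_congr rfl fun f _ => ?_
    simp only [g, Finset.card_filter]
  -- Since `0` lies in the tile, `g x` is one term of a sum equal to `1`: the new pieces are
  -- disjoint.
  have hg1 : ∀ x, g x ≤ 1 := by
    intro x
    rw [← hg ⟨0, hk⟩ x]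
    have := Finset.single_le_sum (f := fun f => g (x - f)) (fun _ _ => Nat.zero_le _)
      (h0 ⟨0, hk⟩)
    simpa using this
  refine ⟨{x | g x = 1}, ∏ W ∈ I, p W, fun i => isCoTile_iff.mpr fun x => ?_,
    Finset.prod_pos fun W _ => hp W, fun x s => ?_⟩
  · rw [reprCount_eq_sum]
    refine Eq.trans ?_ (hg i x)
    refine Finset.sum_congr rfl fun f _ => ?_
    have := hg1 (x - f)
    rcases Nat.le_one_iff_eq_zero_or_eq_one.mp this with h | h <;> simp [h]
  · have hgp : g (x + (∏ W ∈ I, p W) • s) = g x := by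
      simp only [g]
      congr 1
      refine Finset.filter_congr fun W hW => ?_
      obtain ⟨q, hq⟩ := Finset.dvd_prod_of_mem p hW
      rw [hq, mul_smul, (hB' W hW).1]
    exact iff_of_eq (congrArg (· = 1) hgp)

end Assembly

/-! ### Integral functionals cutting out hyperplanes -/

section LinearAlgebra

lemma hasFiniteQuotients_int (d : ℕ) : HasFiniteQuotients (Fin d → ℤ) := by
  intro N hN
  refine ⟨Fintype.piFinset fun _ => Finset.Ico 0 (N : ℤ), fun x => ⟨fun j => x j % N, ?_,
    fun j => x j / N, ?_⟩⟩
  · have hN' : (0 : ℤ) < N := by exact_mod_cast hN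
    exact Fintype.mem_piFinset.mpr fun j =>
      Finset.mem_Ico.mpr ⟨Int.emod_nonneg _ hN'.ne', Int.emod_lt_of_pos _ hN'⟩
  · ext j
    simp [Int.emod_add_mul_ediv]

lemma isPeriodicOfRank_of_add_smul_mem {d : ℕ} {A : Set (Fin d → ℤ)} {p : ℕ} (hp : 0 < p)
    (hA : ∀ x s, x + p • s ∈ A ↔ x ∈ A) : IsPeriodicOfRank d A := by
  let f : (Fin d → ℤ) →+ (Fin d → ℤ) := nsmulAddMonoidHom p
  let L : AddSubgroup (Fin d → ℤ) := f.range
  refine ⟨L, ?_, ?_⟩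
  · let g : (Fin d → ℤ) →ₗ[ℤ] L := f.rangeRestrict.toIntLinearMap
    have hg : Function.Injective g := by
      intro x y hxy
      have h1 : p • x = p • y := congrArg Subtype.val hxy
      exact smul_right_injective _ hp.ne' h1
    have := LinearMap.rank_le_of_injective g hg
    simpa using this
  · ext x
    constructor
    · rintro ⟨a, ha, _, ⟨s, rfl⟩, rfl⟩
      exact (hA a s).mpr ha
    · intro hx
      exact ⟨x, hx, 0, L.zero_mem, add_zero x⟩

/-- Take `l x` to be the determinant of `v` with last row `x`. With an `e` of determinant `c`,
Cramer's rule expands `c • x` in `v` and `e`; the coefficient of `e` is `l x`. -/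
lemma exists_functional_of_linearIndependent {K : ℕ} {v : Fin (K + 1) → Fin (K + 2) → ℤ}
    (hv : LinearIndependent ℤ v) : ∃ (l : (Fin (K + 2) → ℤ) →+ ℤ) (c : ℕ), 0 < c ∧
      (∃ e, l e = c) ∧ (∀ i, l (v i) = 0) ∧
      ∀ x, l x = 0 → ∃ u : Fin (K + 1) → ℤ, c • x = ∑ i, u i • v i := by
  obtain ⟨e₀, he₀⟩ := exists_linearIndependent_snoc_of_lt_finrank (R := ℤ) hv (by simp)
  let l : (Fin (K + 2) → ℤ) →ₗ[ℤ] ℤ :=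
    (Matrix.detRowAlternating (n := Fin (K + 2)) (R := ℤ)).toMultilinearMap.toLinearMap
      (Fin.snoc (α := fun _ => Fin (K + 2) → ℤ) v 0) (Fin.last _)
  have hl : ∀ x, l x = Matrix.det (Matrix.of (Fin.snoc (α := fun _ => Fin (K + 2) → ℤ) v x)) := by
    intro x
    change Matrix.detRowAlternating (Function.update _ _ _) = _
    rw [Fin.update_snoc_last]
    rfl
  have hvec : ∀ (e : Fin (K + 2) → ℤ) (w : Fin (K + 2) → ℤ),
      Matrix.vecMul w (Matrix.of (Fin.snoc (α := fun _ => Fin (K + 2) → ℤ) v e)) =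
      ∑ i, w i • (Fin.snoc (α := fun _ => Fin (K + 2) → ℤ) v e) i := by
    intro e w
    rw [Matrix.vecMul_eq_sum]; rfl
  have hne : l e₀ ≠ 0 := by
    rw [hl]
    intro h0
    obtain ⟨w, hw, hw0⟩ := Matrix.exists_vecMul_eq_zero_iff.mpr h0
    rw [hvec] at hw0
    exact hw (funext (Fintype.linearIndependent_iff.mp he₀ w hw0))
  obtain ⟨e, c, hc, hec⟩ : ∃ (e : Fin (K + 2) → ℤ) (c : ℕ), 0 < c ∧ l e = c := by
    rcases Int.natAbs_eq (l e₀) with h | h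
    · exact ⟨e₀, _, Int.natAbs_pos.mpr hne, h⟩
    · exact ⟨-e₀, _, Int.natAbs_pos.mpr hne, by rw [map_neg]; omega⟩
  refine ⟨l.toAddMonoidHom, c, hc, ⟨e, hec⟩, fun i => ?_, fun x hx => ?_⟩
  · change l (v i) = 0
    rw [hl]
    refine Matrix.det_zero_of_row_eq (i := i.castSucc) (j := Fin.last _)
      (Fin.castSucc_lt_last i).ne ?_
    change Fin.snoc (α := fun _ => Fin (K + 2) → ℤ) v (v i) i.castSucc =
      Fin.snoc (α := fun _ => Fin (K + 2) → ℤ) v (v i) (Fin.last _)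
    rw [Fin.snoc_castSucc, Fin.snoc_last]
  · replace hx : l x = 0 := hx
    set A := Matrix.of (Fin.snoc (α := fun _ => Fin (K + 2) → ℤ) v e) with hA
    have h1 := Matrix.mulVec_cramer A.transpose x
    rw [Matrix.mulVec_transpose, hA, hvec, Matrix.det_transpose, ← hl, hec,
      Fin.sum_univ_castSucc] at h1
    have hlast : (Matrix.cramer A.transpose x) (Fin.last _) = 0 := by
      rw [Matrix.cramer_transpose_apply, ← hx, hl]
      congr 1
      ext i j
      refine Fin.lastCases ?_ (fun i => ?_) i
      · simp
      · rw [Matrix.updateRow_ne (Fin.castSucc_lt_last i).ne]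
        simp [hA]
    rw [← hA, hlast, zero_smul, add_zero] at h1
    refine ⟨fun i => Matrix.cramer A.transpose x i.castSucc, ?_⟩
    rw [← natCast_zsmul, ← h1]
    simp

/-- Ensures that tuples with the same real span yield functionals with the same kernel. -/
lemma functional_eq_zero_iff_mem_realSpan {d k : ℕ} {v : Fin k → Fin d → ℤ}
    {l : (Fin d → ℤ) →+ ℤ} {c : ℕ} (hc : 0 < c) (hl : ∀ i, l (v i) = 0)
    (hker : ∀ x, l x = 0 → ∃ u : Fin k → ℤ, c • x = ∑ i, u i • v i) (x : Fin d → ℤ) :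
    l x = 0 ↔ (fun j => (x j : ℝ)) ∈ realSpan v := by
  constructor
  · intro hx
    obtain ⟨u, hu⟩ := hker x hx
    have hc' : (c : ℝ) ≠ 0 := by positivity
    have h1 : (fun j => (x j : ℝ)) = (c : ℝ)⁻¹ • ∑ i, (u i : ℝ) • fun j => (v i j : ℝ) := by
      ext j
      have := congrFun hu j
      simp only [Pi.smul_apply, Finset.sum_apply, nsmul_eq_mul, smul_eq_mul] at this
      have h2 : (c : ℝ) * x j = ∑ i, (u i : ℝ) * v i j := by exact_mod_cast this
      simp only [Pi.smul_apply, Finset.sum_apply, smul_eq_mul]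
      rw [← h2]
      field_simp
    rw [h1]
    exact Submodule.smul_mem _ _ (Submodule.sum_mem _ fun i _ => Submodule.smul_mem _ _
      (Submodule.subset_span ⟨i, rfl⟩))
  · intro hx
    let L : (Fin d → ℝ) →ₗ[ℝ] ℝ := ∑ j, (l (Pi.single j 1) : ℝ) • LinearMap.proj j
    have hL : ∀ y : Fin d → ℤ, L (fun j => (y j : ℝ)) = (l y : ℝ) := by
      intro y
      have h1 : y = ∑ j, y j • (Pi.single j 1 : Fin d → ℤ) := by
        ext j
        simp [Finset.sum_apply, Pi.single_apply]
      conv_rhs => rw [h1, map_sum]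
      simp only [map_zsmul, smul_eq_mul, Int.cast_sum, Int.cast_mul]
      simp [L, mul_comm]
    have hle : realSpan v ≤ LinearMap.ker L := by
      refine Submodule.span_le.mpr ?_
      rintro _ ⟨i, rfl⟩
      change L _ = 0
      rw [hL, hl, Int.cast_zero]
    have := hle hx
    rw [LinearMap.mem_ker, hL] at this
    exact_mod_cast this

/-- With `D = |l g|`, the value `l (D • t)` is a multiple of `l g` and is cancelled by a multiple of
`g`, which lies in `ker l'`. -/
lemma exists_splitting {G : Type*} [AddCommGroup G] {l l' : G →+ ℤ} {g : G} (hg : l g ≠ 0)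
    (hg' : l' g = 0) : ∃ D : ℕ, 0 < D ∧ ∀ t, ∃ a b, l a = 0 ∧ l' b = 0 ∧ D • t = a + b := by
  refine ⟨(l g).natAbs, Int.natAbs_pos.mpr hg, fun t => ?_⟩
  rcases Int.natAbs_eq (l g) with h | h
  · refine ⟨(l g).natAbs • t - l t • g, l t • g, ?_, ?_, by abel⟩
    · rw [map_sub, map_nsmul, map_zsmul, nsmul_eq_mul, ← h, smul_eq_mul]; ring
    · rw [map_zsmul, hg', smul_zero]
  · refine ⟨(l g).natAbs • t + l t • g, -(l t • g), ?_, ?_, by abel⟩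
    · rw [map_add, map_nsmul, map_zsmul, nsmul_eq_mul, smul_eq_mul]
      linear_combination (l t) * h
    · rw [map_neg, map_zsmul, hg', smul_zero, neg_zero]

end LinearAlgebra

lemma isTiled_indicator {G : Type*} [AddCommGroup G] {F : ℕ → Finset G} {K Q : ℕ} {A : Set G}
    (hA : ∀ i < K, IsCoTile (F i) A) (hQ : ∀ i < K, (F i).card.factorial ∣ Q) :
    IsTiled F K Q (A.indicator fun _ => (1 : ℝ)) := by
  classical
  refine ⟨fun x => ?_, fun i hi n x => ?_⟩
  · by_cases hx : x ∈ A <;> simp [hx]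
  · have h1 := sum_translate_one_add_mul_smul (F i) (a := fun x => if x ∈ A then 1 else 0)
      (fun x => by split_ifs <;> simp) id (fun x => by
        exact reprCount_eq_sum.symm.trans (isCoTile_iff.mp (hA i hi) x)) (hQ i hi) n x
    have h2 := congrArg (Nat.cast : ℕ → ℝ) h1
    rw [Nat.cast_one, Nat.cast_sum] at h2
    refine Eq.trans ?_ h2
    refine Finset.sum_congr rfl fun g _ => ?_
    by_cases hx : x - (1 + Q * n) • g ∈ A <;> simp [hx]

theorem exists_periodic_of_propertyStar {K : ℕ} {F : Fin (K + 1) → Finset (Fin (K + 2) → ℤ)}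
    (h0 : ∀ i, 0 ∈ F i)
    (hind : ∀ v : Fin (K + 1) → Fin (K + 2) → ℤ, IsNonzeroChoice F v → LinearIndependent ℤ v)
    (hstar : ∀ v w : Fin (K + 1) → Fin (K + 2) → ℤ, IsNonzeroChoice F v → IsNonzeroChoice F w →
      realSpan v = realSpan w → ∀ i : Fin (K + 1), (i : ℕ) < K → v i = w i)
    {A : Set (Fin (K + 2) → ℤ)} (hA : IsJointCoTile F A) :
    ∃ A' : Set (Fin (K + 2) → ℤ), IsJointCoTile F A' ∧ IsPeriodicOfRank (K + 2) A' := by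
  classical
  -- The default `{0}` is never consulted: only indices below `K + 1` occur.
  let F' : ℕ → Finset (Fin (K + 2) → ℤ) := fun i => if h : i < K + 1 then F ⟨i, h⟩ else {0}
  have hF' : ∀ i : Fin (K + 1), F' i = F i := fun i => dif_pos i.2
  have hF'' : ∀ i (hi : i < K + 1), F' i = F ⟨i, hi⟩ := fun i hi => hF' ⟨i, hi⟩
  let tup : (ℕ → Fin (K + 2) → ℤ) → Fin (K + 1) → Fin (K + 2) → ℤ := fun v i => v i
  let key : (ℕ → Fin (K + 2) → ℤ) → Submodule ℝ (Fin (K + 2) → ℝ) := fun v => realSpan (tup v)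
  have hchoice : ∀ v ∈ choices F' (K + 1), IsNonzeroChoice F (tup v) := by
    intro v hv i
    rw [← hF' i]
    exact (mem_choices.mp hv).1 i i.2
  have hfun : ∀ v, ∃ (l : (Fin (K + 2) → ℤ) →+ ℤ) (c : ℕ), 0 < c ∧ (v ∈ choices F' (K + 1) →
      (∃ e, l e = c) ∧ (∀ x : Fin (K + 2) → ℤ, l x = 0 ↔ (fun j => (x j : ℝ)) ∈ key v) ∧
      ∀ x, l x = 0 → ∃ u : Fin (K + 1) → ℤ, c • x = ∑ i, u i • tup v i) := by
    intro v
    by_cases hv : v ∈ choices F' (K + 1)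
    · obtain ⟨l, c, hc, he, hl, hker⟩ :=
        exists_functional_of_linearIndependent (hind _ (hchoice v hv))
      exact ⟨l, c, hc, fun _ => ⟨he, functional_eq_zero_iff_mem_realSpan hc hl hker, hker⟩⟩
    · exact ⟨0, 1, one_pos, fun h => absurd h hv⟩
  choose lv c hc hlv using hfun
  -- One tuple is picked per hyperplane; the kernel does not depend on the pick.
  let l : Submodule ℝ (Fin (K + 2) → ℝ) → (Fin (K + 2) → ℤ) →+ ℤ := fun W =>
    if h : ∃ v ∈ choices F' (K + 1), key v = W then lv h.choose else 0
  have hl : ∀ v ∈ choices F' (K + 1), ∃ w ∈ choices F' (K + 1), key w = key v ∧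
      l (key v) = lv w := by
    intro v hv
    have h : ∃ w ∈ choices F' (K + 1), key w = key v := ⟨v, hv, rfl⟩
    exact ⟨h.choose, h.choose_spec.1, h.choose_spec.2, dif_pos h⟩
  have hl0 : ∀ v ∈ choices F' (K + 1), ∀ x : Fin (K + 2) → ℤ,
      l (key v) x = 0 ↔ (fun j => (x j : ℝ)) ∈ key v := by
    intro v hv x
    obtain ⟨w, hw, hwv, hlw⟩ := hl v hv
    rw [hlw, ← hwv]
    exact (hlv w hw).2.1 x
  set N := ∏ v ∈ choices F' (K + 1), c v with hN
  have hN0 : 0 < N := Finset.prod_pos fun v _ => hc v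
  have hker : ∀ v ∈ choices F' (K + 1), ∀ s, l (key v) s = 0 →
      ∃ u : ℕ → ℤ, N • s = ∑ i ∈ Finset.range (K + 1), u i • v i := by
    intro v hv s hs
    obtain ⟨u, hu⟩ := (hlv v hv).2.2 s (((hlv v hv).2.1 s).mpr ((hl0 v hv s).mp hs))
    obtain ⟨q, hq⟩ := Finset.dvd_prod_of_mem c hv
    refine ⟨fun i => if h : i < K + 1 then q * u ⟨i, h⟩ else 0, ?_⟩
    rw [hN, hq, mul_comm, mul_smul, hu, Finset.smul_sum, Finset.sum_range]
    refine Finset.sum_congr rfl fun i _ => ?_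
    beta_reduce
    rw [dif_pos i.2, mul_smul, natCast_zsmul]
  have hpos : ∀ v ∈ choices F' (K + 1), ∃ e, 0 < l (key v) e := by
    intro v hv
    obtain ⟨w, hw, -, hlw⟩ := hl v hv
    obtain ⟨e, he⟩ := (hlv w hw).1
    exact ⟨e, by rw [hlw, he]; exact_mod_cast hc w⟩
  have hvkey : ∀ v : ℕ → Fin (K + 2) → ℤ, ∀ i : Fin (K + 1),
      (fun j => (v i j : ℝ)) ∈ key v := fun v i => Submodule.subset_span ⟨i, rfl⟩
  have hnle : ∀ v ∈ choices F' (K + 1), ∀ w ∈ choices F' (K + 1), ¬ key w ≤ key v →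
      ∃ g, l (key v) g ≠ 0 ∧ l (key w) g = 0 := by
    intro v hv w hw hle
    by_contra! hcon
    refine hle (Submodule.span_le.mpr ?_)
    rintro _ ⟨i, rfl⟩
    by_contra hmem
    exact hcon (w i) (fun h => hmem ((hl0 v hv _).mp h)) ((hl0 w hw _).mpr (hvkey w i))
  have hpair : ∀ q : (ℕ → Fin (K + 2) → ℤ) × (ℕ → Fin (K + 2) → ℤ), ∃ D : ℕ, 0 < D ∧
      (q.1 ∈ choices F' (K + 1) → q.2 ∈ choices F' (K + 1) → key q.1 ≠ key q.2 →
      ∀ t, ∃ a b, l (key q.1) a = 0 ∧ l (key q.2) b = 0 ∧ D • t = a + b) := by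
    rintro ⟨v, w⟩
    by_cases h : v ∈ choices F' (K + 1) ∧ w ∈ choices F' (K + 1) ∧ key v ≠ key w
    · obtain ⟨hv, hw, hne⟩ := h
      by_cases hle : key w ≤ key v
      · obtain ⟨g, h1, h2⟩ := hnle w hw v hv fun h => hne (le_antisymm h hle)
        obtain ⟨D, hD, h⟩ := exists_splitting h1 h2
        refine ⟨D, hD, fun _ _ _ t => ?_⟩
        obtain ⟨a, b, ha, hb, hab⟩ := h t
        exact ⟨b, a, hb, ha, hab.trans (add_comm a b)⟩
      · obtain ⟨g, h1, h2⟩ := hnle v hv w hw hle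
        obtain ⟨D, hD, h⟩ := exists_splitting h1 h2
        exact ⟨D, hD, fun _ _ _ => h⟩
    · exact ⟨1, one_pos, fun h1 h2 h3 => absurd ⟨h1, h2, h3⟩ h⟩
  choose D₀ hD₀ hD₀' using hpair
  set D := ∏ q ∈ choices F' (K + 1) ×ˢ choices F' (K + 1), D₀ q with hD
  have hDpos : 0 < D := Finset.prod_pos fun q _ => hD₀ q
  have hsep : ∀ v ∈ choices F' (K + 1), ∀ w ∈ choices F' (K + 1), key v ≠ key w → ∀ t, ∃ a b,
      l (key v) a = 0 ∧ l (key w) b = 0 ∧ D • t = a + b := by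
    intro v hv w hw hne t
    obtain ⟨q, hq⟩ := Finset.dvd_prod_of_mem D₀ (Finset.mk_mem_product hv hw)
    obtain ⟨a, b, ha, hb, hab⟩ := hD₀' (v, w) hv hw hne (q • t)
    exact ⟨a, b, ha, hb, by rw [hD, hq, mul_smul, hab]⟩
  have hkeystar : ∀ v ∈ choices F' (K + 1), ∀ w ∈ choices F' (K + 1), key v = key w →
      ∀ i < K, v i = w i := fun v hv w hw hvw i hi =>
    hstar _ _ (hchoice v hv) (hchoice w hw) hvw ⟨i, by omega⟩ hi
  have htiled : IsTiled F' (K + 1) (∏ i ∈ Finset.range (K + 1), (F' i).card.factorial)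
      (A.indicator fun _ => (1 : ℝ)) := by
    refine isTiled_indicator (fun i hi => ?_) fun i hi =>
      Finset.dvd_prod_of_mem (fun i => (F' i).card.factorial) (Finset.mem_range.mpr hi)
    rw [hF'' i hi]
    exact hA _
  obtain ⟨n, hn, hgood⟩ := exists_good (hasFiniteQuotients_int (K + 2)) htiled
    (Finset.prod_pos fun i _ => Nat.factorial_pos _) (fun x => by
      by_cases hx : x ∈ A
      · exact ⟨1, by simp [hx]⟩
      · exact ⟨0, by simp [hx]⟩) (fun i hi => by rw [hF'' i hi]; exact h0 _)
    hkeystar hN0 hDpos hker hpos hsep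
  have hI : ∀ W ∈ (choices F' (K + 1)).image key, ∃ v ∈ choices F' (K + 1), key v = W :=
    fun W hW => Finset.mem_image.mp hW
  obtain ⟨A', p, hA', hp, hper⟩ := exists_periodic_of_good (hasFiniteQuotients_int (K + 2))
    (Nat.succ_pos K) h0 hA (I := (choices F' (K + 1)).image key) hn hDpos
    (fun W hW => by obtain ⟨v, hv, rfl⟩ := hI W hW; exact hpos v hv)
    (fun W hW W' hW' hne => by
      obtain ⟨v, hv, rfl⟩ := hI W hW
      obtain ⟨w, hw, rfl⟩ := hI W' hW'
      exact hsep v hv w hw hne)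
    (hgood.mono fun W ⟨v, hv, hvW⟩ => Finset.mem_coe.mpr (Finset.mem_image.mpr ⟨v, hv, hvW⟩))
  exact ⟨A', hA', isPeriodicOfRank_of_add_smul_mem hp hper⟩

end JointTiling

theorem corollary1p6 (d : ℕ) (hd : 2 ≤ d) (F : Fin (d - 1) → Finset (Fin d → ℤ))
    (hF : JointTiling.PropertyStar F)
    (hA : ∃ A : Set (Fin d → ℤ), JointTiling.IsJointCoTile F A) :
    ∃ A' : Set (Fin d → ℤ),
      JointTiling.IsJointCoTile F A' ∧ JointTiling.IsPeriodicOfRank d A' := by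
  -- With `d = K + 2`, the subtractions `d - 1` and `d - 2` reduce definitionally to `K + 1` and
  -- `K`.
  obtain ⟨K, rfl⟩ := Nat.exists_eq_add_of_le' hd
  obtain ⟨A, hA⟩ := hA
  exact JointTiling.exists_periodic_of_propertyStar (K := K) hF.1.1 hF.1.2 hF.2 hA
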